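/- Let $\Gamma=(\mathcal V,\mathcal E)$ be a finite directed graph with non-empty vertex set (loops and multiple edges allowed) which is strongly connected: for any $u,v\in\mathcal V$ there is a directed path from $u$ to $v$. To each edge $e$ let a contracting similarity $S_e:\mathbb R\to\mathbb R$ be given, i.e. $|S_e(x)-S_e(y)|=c_e|x-y|$ for all $x,y\in\mathbb R$ with some $c_e\in(0,1)$, and assume $S_e([0,1])\subseteq[0,1]$. Let $\{F_v\}_{v\in\mathcal V}$ be the associated family of graph-directed self-similar sets, i.e. the non-empty compact sets $F_v\subseteq[0,1]$ with $$F_v=\bigcup_{u\in\mathcal V}\ \bigcup_{e\in\mathcal E_{u,v}}S_e(F_u)\qquad(v\in\mathcal V),$$ where $\mathcal E_{u,v}$ is the set of edges from $u$ to $v$. For a finite directed path $\mathbf e=e_1e_2\cdots e_n$ put $S_{\mathbf e}=S_{e_n}\circ\cdots\circ S_{e_1}$ (the empty path gives the identity). The graph-directed weak separation property (GDWSP) holds if for every $v\in\mathcal V$ (equivalently, for some $v$) the identity is an isolated point, in the topology of pointwise convergence, of the set of all maps $S_{\mathbf e}^{-1}\circ S_{\mathbf f}$, where $\mathbf e,\mathbf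 f$ are finite directed paths from $v$ to $v$. For $E\subseteq\mathbb R$ and $r>0$ let $N_r(E)$ be the smallest number of open sets of diameter at most $r$ needed to cover $E$. The Assouad dimension $\dim_{\mathrm A}F$ of a non-empty set $F\subseteq\mathbb R$ is the infimum of all $t\ge 0$ for which there is $C>0$ such that $N_r(B(x,R)\cap F)\le C(R/r)^t$ for all $R>0$, $0<r<R$ and $x\in F$, where $B(x,R)$ is the open ball. Let $\dim_{\mathrm H}$ denote Hausdorff dimension and $\mathcal H^s$ the $s$-dimensional Hausdorff measure. Then the sets $F_v$ have a common Hausdorff dimension $s$. Suppose that $s<1$. 1. If the GDWSP is satisfied, then for all $v\in\mathcal V$ we have $\mathcal H^s(F_v)>0$ and $\dim_{\mathrm A}F_v=\dim_{\mathrm H}F_v=s<1$. 2. If the GDWSP is not satisfied, and the sets $F_v$ are not all singletons, then for all $v\in\mathcal V$ we have $\mathcal H^s(F_v)=0$ and $\dim_{\mathrm A}F_v=1$. -/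

import Mathlib

open Set Topology MeasureTheory
open scoped NNReal ENNReal

namespace GraphDirected

/-- `coverNumber r E` is the smallest number of open sets of diameter at most `r`
needed to cover `E` (it is `⊤` if no finite number suffices). -/
noncomputable def coverNumber {X : Type*} [MetricSpace X] (r : ℝ) (E : Set X) : ℕ∞ :=
  ⨅ (𝒰 : Set (Set X)) (_ : ∀ U ∈ 𝒰, IsOpen U ∧ Metric.ediam U ≤ ENNReal.ofReal r)
    (_ : E ⊆ ⋃₀ 𝒰), 𝒰.encard

/-- The Assouad dimension of `F`: the infimum of all `s ≥ 0` for which there is `C > 0` with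
`N_r(B(x, R) ∩ F) ≤ C (R / r) ^ s` for all `R > 0`, `0 < r < R` and `x ∈ F`. -/
noncomputable def dimAssouad {X : Type*} [MetricSpace X] (F : Set X) : ℝ≥0∞ :=
  ⨅ (s : ℝ≥0) (_ : ∃ C : ℝ, 0 < C ∧ ∀ R : ℝ, 0 < R → ∀ r : ℝ, 0 < r → r < R → ∀ x ∈ F,
    (coverNumber r (Metric.ball x R ∩ F) : ℝ≥0∞) ≤ ENNReal.ofReal (C * (R / r) ^ (s : ℝ))),
    (s : ℝ≥0∞)

/-- A contracting similarity of the real line. -/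
def IsContractingSimilarity (f : ℝ → ℝ) : Prop :=
  ∃ c : ℝ, 0 < c ∧ c < 1 ∧ ∀ x y : ℝ, |f x - f y| = c * |x - y|

variable {V : Type*} [Quiver V]

/-- A system of contracting similarities of the line, one for every edge of the directed graph,
each mapping `[0,1]` into itself. -/
structure IsSimilaritySystem (S : ∀ u v : V, (u ⟶ v) → ℝ → ℝ) : Prop where
  similarity : ∀ {u v : V} (e : u ⟶ v), IsContractingSimilarity (S u v e)
  mapsTo : ∀ {u v : V} (e : u ⟶ v), MapsTo (S u v e) (Icc 0 1) (Icc 0 1)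

/-- `F` is the family of graph-directed self-similar sets of the system `S`: a tuple of non-empty
compact subsets of `[0,1]`, indexed by the vertices, such that `F v` is the union of
the sets `S u v e '' F u` over all vertices `u` and all edges `e` from `u` to `v`. -/
structure IsAttractorFamily (S : ∀ u v : V, (u ⟶ v) → ℝ → ℝ) (F : V → Set ℝ) : Prop where
  isCompact : ∀ v, IsCompact (F v)
  nonempty : ∀ v, (F v).Nonempty
  subset : ∀ v, F v ⊆ Icc 0 1
  eq_iUnion : ∀ v, F v = ⋃ (u : V) (e : u ⟶ v), S u v e '' F u

/-- The similarity attached to a finite directed path from `u` to `v`, obtained by composing the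
maps of its edges in the order in which they are traversed (the map of the first edge is applied
first), so that it maps `F u` into `F v`. The empty path gives the identity. -/
def pathMap (S : ∀ u v : V, (u ⟶ v) → ℝ → ℝ) {u : V} : ∀ {v : V}, Quiver.Path u v → ℝ → ℝ
  | _, Quiver.Path.nil => id
  | _, Quiver.Path.cons p e => S _ _ e ∘ pathMap S p

/-- The set of all maps `S_𝐞⁻¹ ∘ S_𝐟`, where `𝐞` and `𝐟` are finite directed paths
from `u` to `v`. (The path maps of a similarity system are bijections of `ℝ`, see
`IsSimilaritySystem.bijective_pathMap`, so `Function.invFun` is the genuine inverse.) -/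
noncomputable def quotientMaps (S : ∀ u v : V, (u ⟶ v) → ℝ → ℝ) (u v : V) : Set (ℝ → ℝ) :=
  {g | ∃ p q : Quiver.Path u v, g = Function.invFun (pathMap S p) ∘ pathMap S q}

/-- The identity is an isolated point of the set of maps `S_𝐞⁻¹ ∘ S_𝐟` from `v` to `v`,
in the topology of pointwise convergence (the product topology on `ℝ → ℝ`). -/
def IdIsolatedAt (S : ∀ u v : V, (u ⟶ v) → ℝ → ℝ) (v : V) : Prop :=
  ∃ U : Set (ℝ → ℝ), IsOpen U ∧ U ∩ quotientMaps S v v = {id}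

/-- The graph-directed weak separation property. For strongly connected graphs it is
equivalent to ask for the condition at a single vertex, see `gdwsp_iff_exists`. -/
def GDWSP (S : ∀ u v : V, (u ⟶ v) → ℝ → ℝ) : Prop :=
  ∀ v : V, IdIsolatedAt S v

section Helpers

variable {S : ∀ u v : V, (u ⟶ v) → ℝ → ℝ}

theorem IsSimilaritySystem.exists_ratio (hS : IsSimilaritySystem S) {u v : V}
    (p : Quiver.Path u v) :
    ∃ c : ℝ, 0 < c ∧ ∀ x y : ℝ, |pathMap S p x - pathMap S p y| = c * |x - y| := by
  induction p with
  | nil => exact ⟨1, one_pos, fun x y => by simp [pathMap]⟩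
  | cons p e ih =>
    obtain ⟨c, hc, h⟩ := ih
    obtain ⟨d, hd, -, h'⟩ := hS.similarity e
    exact ⟨d * c, mul_pos hd hc, fun x y => by simp [pathMap, h', h, mul_assoc]⟩

theorem IsSimilaritySystem.bijective_pathMap (hS : IsSimilaritySystem S) {u v : V}
    (p : Quiver.Path u v) : Function.Bijective (pathMap S p) := by
  obtain ⟨c, hc, h⟩ := hS.exists_ratio p
  have hi : Isometry (fun x => c⁻¹ * pathMap S p x) := by
    refine Isometry.of_dist_eq fun x y => ?_
    rw [Real.dist_eq, Real.dist_eq, ← mul_sub, abs_mul, h, abs_of_pos (inv_pos.2 hc),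
      inv_mul_cancel_left₀ hc.ne']
  refine ⟨fun x y hxy => hi.injective (by simp [hxy]), fun y => ?_⟩
  let L := hi.affineIsometryOfStrictConvexSpace.linearIsometry
  have hL : Function.Surjective L :=
    LinearMap.surjective_of_injective (f := L.toLinearMap) L.injective
  have hA : Function.Surjective hi.affineIsometryOfStrictConvexSpace :=
    hi.affineIsometryOfStrictConvexSpace.toAffineMap.linear_surjective_iff.1 hL
  obtain ⟨x, hx⟩ := hA (c⁻¹ * y)
  refine ⟨x, ?_⟩
  have hx' : c⁻¹ * pathMap S p x = c⁻¹ * y := hx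
  exact mul_left_cancel₀ (inv_ne_zero hc.ne') hx'

theorem IsSimilaritySystem.continuous_invFun_pathMap (hS : IsSimilaritySystem S) {u v : V}
    (p : Quiver.Path u v) : Continuous (Function.invFun (pathMap S p)) := by
  obtain ⟨c, hc, h⟩ := hS.exists_ratio p
  have hr := Function.rightInverse_invFun (hS.bijective_pathMap p).surjective
  refine (LipschitzWith.of_dist_le_mul (K := ⟨c⁻¹, (inv_pos.2 hc).le⟩) fun x y => ?_).continuous
  have := h (Function.invFun (pathMap S p) x) (Function.invFun (pathMap S p) y)
  rw [hr x, hr y] at this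
  rw [Real.dist_eq, Real.dist_eq, this]
  exact (inv_mul_cancel_left₀ hc.ne' _).ge

theorem pathMap_comp {u v w : V} (p : Quiver.Path u v) (q : Quiver.Path v w) :
    pathMap S (p.comp q) = pathMap S q ∘ pathMap S p := by
  induction q with
  | nil => rfl
  | cons q e ih => simp [pathMap, ih, Function.comp_assoc]

theorem IsSimilaritySystem.idIsolatedAt_of (hS : IsSimilaritySystem S)
    (hV : Quiver.IsStronglyConnected V) {u v : V} (h : IdIsolatedAt S v) :
    IdIsolatedAt S u := by
  obtain ⟨U, hU, hUv⟩ := h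
  obtain ⟨a⟩ := hV v u
  obtain ⟨b⟩ := hV u v
  have ha := hS.bijective_pathMap a
  have hal := Function.leftInverse_invFun ha.injective
  have har := Function.rightInverse_invFun ha.surjective
  let Φ : (ℝ → ℝ) → ℝ → ℝ := fun g => Function.invFun (pathMap S a) ∘ g ∘ pathMap S a
  have hΦ : Continuous Φ := continuous_pi fun x =>
    (hS.continuous_invFun_pathMap a).comp (continuous_apply (pathMap S a x))
  have hΦid : Φ id = id := funext fun x => hal x
  refine ⟨Φ ⁻¹' U, hU.preimage hΦ, ?_⟩
  ext g
  simp only [mem_inter_iff, mem_preimage, mem_singleton_iff]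
  constructor
  · rintro ⟨hg, p, q, rfl⟩
    set g := Function.invFun (pathMap S p) ∘ pathMap S q with hgdef
    have hmem : Φ g ∈ quotientMaps S v v := by
      refine ⟨(a.comp p).comp b, (a.comp q).comp b, ?_⟩
      have hinj := hS.bijective_pathMap ((a.comp p).comp b)
      funext x
      apply hinj.injective
      have e1 := Function.rightInverse_invFun hinj.surjective
        (pathMap S ((a.comp q).comp b) x)
      have e2 := Function.rightInverse_invFun (hS.bijective_pathMap p).surjective
        (pathMap S q (pathMap S a x))
      simp only [Function.comp_apply, e1]
      simp only [pathMap_comp, Function.comp_apply, Φ, har _, hgdef, e2]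
    have hid : Φ g = id := by
      have : Φ g ∈ U ∩ quotientMaps S v v := ⟨hg, hmem⟩
      rwa [hUv] at this
    funext y
    obtain ⟨x, rfl⟩ := ha.surjective y
    have := congrArg (pathMap S a) (congrFun hid x)
    simpa only [Φ, Function.comp_apply, har _, id] using this
  · rintro rfl
    have hidU : (id : ℝ → ℝ) ∈ U ∩ quotientMaps S v v := by rw [hUv]; rfl
    refine ⟨by rw [hΦid]; exact hidU.1, Quiver.Path.nil, Quiver.Path.nil, ?_⟩
    funext x
    exact (Function.leftInverse_invFun
      (hS.bijective_pathMap (Quiver.Path.nil : Quiver.Path u u)).injective x).symm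

/-- Over a strongly connected graph the weak separation condition at one vertex
is equivalent to the condition at all vertices. -/
theorem IsSimilaritySystem.gdwsp_iff_exists [Nonempty V] (hS : IsSimilaritySystem S)
    (hV : Quiver.IsStronglyConnected V) : GDWSP S ↔ ∃ v : V, IdIsolatedAt S v :=
  ⟨fun h => ⟨Classical.arbitrary V, h _⟩, fun ⟨_, hv⟩ _ => hS.idIsolatedAt_of hV hv⟩

end Helpers

end GraphDirected

namespace GraphDirected

open Filter Metric

/-! Three implications carry the theorem. None of them uses any separation between the copies beyond
what it states.

Positive measure bounds the Assouad dimension (`sum_rpow_slope_le`, `exists_card_le_of_separated`).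
Disjoint loop copies of `F v` inside itself have ratios with `∑ cᵢ ^ s ≤ 1`, since otherwise some `t
> s` would have positive `t`-dimensional measure. A Vitali family of loop copies of a fixed ball
efficiently covers `F v`. If that ball held disjoint loop copies of too large total weight, this
cover would be cheaper than positivity of `μH[s]` permits. So a ball of radius `R` holds at most a
constant times `(R / r) ^ s` points of `F v` that are `r`-separated.

Weak separation gives positive measure (`hausdorffMeasure_ne_zero_of_gdwsp`). Distinct cylinders of
comparable size then differ by a definite relative amount, so boundedly many of them meet a ball of
that size. Were `μH[s] (F v) = 0`, a cover of tiny `s`-weight would yield a contracting recurrence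
for covering numbers, hence dimension below `s`.

Failure of weak separation gives Assouad dimension one (`IsCoarselyDense.add`). Two distinct loops
that are relatively almost equal become, after zooming in, almost translates of each other by a
chosen small step. Overlaying the two copies lengthens, relative to the scale, the interval near
which `F v` is dense, by a fixed gain that can be iterated.

The zero measure in the second case follows from the first implication: positive measure would force
Assouad dimension at most `s < 1`. -/

/-! ### Hausdorff measure through finite ball covers -/

theorem ediam_ball_le (x ρ : ℝ) : ediam (ball x ρ) ≤ ENNReal.ofReal (2 * ρ) := by
  refine ediam_le_of_forall_dist_le fun y hy z hz => ?_
  rw [mem_ball] at hy hz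
  linarith [dist_triangle_right y z x]

/-- The finite family `I` of pairs (centre, radius) describes a cover of `K` by balls. -/
structure IsBallCover (K : Set ℝ) (I : Finset (ℝ × ℝ)) : Prop where
  pos : ∀ p ∈ I, 0 < p.2
  cover : K ⊆ ⋃ p ∈ I, ball p.1 p.2

theorem exists_pos_add_rpow_le {s : ℝ} (hs : 0 < s) (a : ℝ) {ε : ℝ} (hε : 0 < ε) :
    ∃ ρ, a < ρ ∧ ρ ^ s < a ^ s + ε := by
  have hc : ContinuousAt (fun x : ℝ => x ^ s) a := Real.continuousAt_rpow_const _ _ (Or.inr hs.le)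
  have h1 : ∀ᶠ x in 𝓝[>] a, x ^ s < a ^ s + ε :=
    (hc.tendsto.mono_left nhdsWithin_le_nhds).eventually_lt_const (by linarith)
  obtain ⟨ρ, h, h'⟩ := (h1.and self_mem_nhdsWithin).exists
  exact ⟨ρ, h', h⟩

theorem exists_isBallCover_of_hausdorffMeasure_eq_zero {K : Set ℝ} (hK : IsCompact K) {s : ℝ}
    (hs : 0 < s) (h : μH[s] K = 0) {ε : ℝ} (hε : 0 < ε) :
    ∃ I, IsBallCover K I ∧ ∑ p ∈ I, p.2 ^ s < ε := by
  classical
  rw [Measure.hausdorffMeasure_apply] at h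
  simp only [ENNReal.iSup_eq_zero] at h
  -- Any finite mesh would do: it only serves to make all diameters finite.
  have h1 := h 1 one_pos
  have h2 : (⨅ (t : ℕ → Set ℝ) (_ : K ⊆ ⋃ n, t n) (_ : ∀ n, ediam (t n) ≤ 1),
      ∑' n, ⨆ _ : (t n).Nonempty, ediam (t n) ^ s) < ENNReal.ofReal (ε / 2) := by
    rw [h1]; simpa using hε
  simp only [iInf_lt_iff] at h2
  obtain ⟨t, hcov, hdiam, hsum⟩ := h2
  obtain ⟨e, he0, b, hesum, he⟩ := posSumOfEncodable (half_pos hε) ℕ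
  have hfin : ∀ n, ediam (t n) ≠ ⊤ := fun n => ((hdiam n).trans_lt ENNReal.one_lt_top).ne
  -- Radii strictly above the diameters, at total cost `ε / 2`, give open balls even around
  -- singletons, so compactness applies.
  choose ρ hρ hρs using fun n =>
    exists_pos_add_rpow_le hs (ediam (t n)).toReal (he0 n)
  have hρ0 : ∀ n, 0 < ρ n := fun n => ENNReal.toReal_nonneg.trans_lt (hρ n)
  let c : ℕ → ℝ := fun n => if hn : (t n).Nonempty then hn.some else 0
  have hsub : ∀ n, t n ⊆ ball (c n) (ρ n) := by
    intro n x hx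
    have hn : (t n).Nonempty := ⟨x, hx⟩
    have hc : c n = hn.some := dif_pos hn
    rw [mem_ball, hc, dist_edist]
    exact (ENNReal.toReal_mono (hfin n) (edist_le_ediam_of_mem hx hn.some_mem)).trans_lt (hρ n)
  obtain ⟨T, hT⟩ := hK.elim_finite_subcover (fun n => ⋃ _ : (t n).Nonempty, ball (c n) (ρ n))
    (fun n => isOpen_iUnion fun _ => isOpen_ball) (fun x hx => by
      obtain ⟨n, hn⟩ := mem_iUnion.1 (hcov hx)
      exact mem_iUnion.2 ⟨n, mem_iUnion.2 ⟨⟨x, hn⟩, hsub n hn⟩⟩)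
  let T' := T.filter fun n => (t n).Nonempty
  refine ⟨T'.image fun n => (c n, ρ n), ⟨fun p hp => ?_, fun x hx => ?_⟩, ?_⟩
  · obtain ⟨n, -, rfl⟩ := Finset.mem_image.1 hp
    exact hρ0 n
  · obtain ⟨n, hn, hx⟩ := mem_iUnion₂.1 (hT hx)
    obtain ⟨hne, hx⟩ := mem_iUnion.1 hx
    exact mem_iUnion₂.2 ⟨(c n, ρ n), Finset.mem_image_of_mem _ (Finset.mem_filter.2 ⟨hn, hne⟩), hx⟩
  · have h3 : ∑ n ∈ T', (ediam (t n)).toReal ^ s < ε / 2 := by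
      rw [← ENNReal.ofReal_lt_ofReal_iff (by positivity), ENNReal.ofReal_sum_of_nonneg
        (fun n _ => by positivity)]
      refine lt_of_le_of_lt ?_ hsum
      refine le_trans (Finset.sum_le_sum fun n hn => ?_) (ENNReal.sum_le_tsum T')
      rw [← ENNReal.ofReal_rpow_of_nonneg ENNReal.toReal_nonneg hs.le,
        ENNReal.ofReal_toReal (hfin n)]
      exact le_iSup (fun _ : (t n).Nonempty => ediam (t n) ^ s) (Finset.mem_filter.1 hn).2
    have h4 : ∑ n ∈ T', e n ≤ ε / 2 :=
      (sum_le_hasSum T' (fun n _ => (he0 n).le) hesum).trans he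
    calc ∑ p ∈ T'.image (fun n => (c n, ρ n)), p.2 ^ s ≤ ∑ n ∈ T', ρ n ^ s :=
          Finset.sum_image_le_of_nonneg fun p hp => by
            obtain ⟨n, -, rfl⟩ := Finset.mem_image.1 hp
            exact Real.rpow_nonneg (hρ0 n).le _
      _ ≤ ∑ n ∈ T', ((ediam (t n)).toReal ^ s + e n) :=
          Finset.sum_le_sum fun n _ => (hρs n).le
      _ < ε := by rw [Finset.sum_add_distrib]; linarith

/-- No bound on the mesh is needed: a sum of `s`-th powers below `ε` forces every radius below `ε ^
s⁻¹`. -/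
theorem hausdorffMeasure_eq_zero_of_isBallCover {K : Set ℝ} {s : ℝ} (hs : 0 < s)
    (h : ∀ ε > 0, ∃ I, IsBallCover K I ∧ ∑ p ∈ I, p.2 ^ s < ε) : μH[s] K = 0 := by
  have hpos : ∀ n : ℕ, (0 : ℝ) < (1 / (n + 1 : ℝ)) := fun n => Nat.one_div_pos_of_nat
  choose I hI hIs using fun n : ℕ => h _ (hpos n)
  have hlim : Tendsto (fun n : ℕ => (1 / (n + 1 : ℝ))) atTop (𝓝 0) :=
    tendsto_one_div_add_atTop_nhds_zero_nat
  have hsmall : ∀ n, ∀ p ∈ I n, p.2 ≤ (1 / (n + 1 : ℝ)) ^ s⁻¹ := by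
    intro n p hp
    have h1 : p.2 ^ s ≤ 1 / (n + 1 : ℝ) :=
      (Finset.single_le_sum (f := fun p : ℝ × ℝ => p.2 ^ s)
        (fun q hq => Real.rpow_nonneg ((hI n).pos q hq).le _) hp).trans (hIs n).le
    calc p.2 = (p.2 ^ s) ^ s⁻¹ := (Real.rpow_rpow_inv ((hI n).pos p hp).le hs.ne').symm
      _ ≤ _ := Real.rpow_le_rpow (Real.rpow_nonneg ((hI n).pos p hp).le _) h1 (by positivity)
  have key := Measure.hausdorffMeasure_le_liminf_sum (ι := fun n => I n) s K (l := atTop)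
    (fun n : ℕ => ENNReal.ofReal (2 * (1 / (n + 1 : ℝ)) ^ s⁻¹)) ?_
    (fun n p => ball p.1.1 p.1.2) (Eventually.of_forall fun n p => ?_)
    (Eventually.of_forall fun n => ?_)
  · refine le_antisymm (key.trans ?_) zero_le
    have hle : ∀ n : ℕ, ∑ p : I n, ediam (ball p.1.1 p.1.2) ^ s ≤
        ENNReal.ofReal (2 ^ s * (1 / (n + 1 : ℝ))) := by
      intro n
      calc ∑ p : I n, ediam (ball p.1.1 p.1.2) ^ s
          ≤ ∑ p : I n, ENNReal.ofReal (2 ^ s * p.1.2 ^ s) := by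
            refine Finset.sum_le_sum fun p _ => ?_
            have hp := (hI n).pos p.1 p.2
            rw [← Real.mul_rpow two_pos.le hp.le, ← ENNReal.ofReal_rpow_of_nonneg (by positivity) hs.le]
            exact ENNReal.rpow_le_rpow (ediam_ball_le _ _) hs.le
        _ = ENNReal.ofReal (∑ p ∈ I n, 2 ^ s * p.2 ^ s) := by
            rw [Finset.sum_coe_sort (I n) fun p : ℝ × ℝ => ENNReal.ofReal (2 ^ s * p.2 ^ s),
              ENNReal.ofReal_sum_of_nonneg]
            intro p hp
            have := (hI n).pos p hp
            positivity
        _ ≤ _ := by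
            rw [← Finset.mul_sum]
            exact ENNReal.ofReal_le_ofReal (by gcongr; exact (hIs n).le)
    have h0 : Tendsto (fun n : ℕ => ENNReal.ofReal (2 ^ s * (1 / (n + 1 : ℝ)))) atTop (𝓝 0) := by
      have := ENNReal.tendsto_ofReal (hlim.const_mul (2 ^ s))
      simpa using this
    rw [← h0.liminf_eq]
    exact liminf_le_liminf (Eventually.of_forall hle)
  · have h1 := (hlim.rpow_const (Or.inr (inv_pos.2 hs).le)).const_mul 2
    rw [Real.zero_rpow (inv_pos.2 hs).ne', mul_zero] at h1
    simpa using ENNReal.tendsto_ofReal h1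
  · exact (ediam_ball_le _ _).trans
      (ENNReal.ofReal_le_ofReal (by linarith [hsmall n p.1 p.2]))
  · intro x hx
    obtain ⟨p, hp, hxp⟩ := mem_iUnion₂.1 ((hI n).cover hx)
    exact mem_iUnion.2 ⟨⟨p, hp⟩, hxp⟩

/-- A finite family of similar copies of `K` inside `K`, at mutual distance at least `η`, with
`∑ cᵢ ^ t ≥ 1` bounds from below the sums of the `t`-th powers of the radii in covers of `K`. -/
theorem le_sum_of_isBallCover {ι : Type*} {K : Set ℝ} (hK : K.Nonempty) {A : Finset ι}
    (hA : 1 < A.card) {f : ι → ℝ → ℝ} {c : ι → ℝ} (hc : ∀ i ∈ A, 0 < c i)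
    (hf : ∀ i ∈ A, ∀ x y, |f i x - f i y| = c i * |x - y|) (hsurj : ∀ i ∈ A, (f i).Surjective)
    (hfK : ∀ i ∈ A, MapsTo (f i) K K) {η : ℝ} (hη : 0 < η)
    (hsep : ∀ i ∈ A, ∀ j ∈ A, i ≠ j → ∀ x ∈ K, ∀ y ∈ K, η ≤ |f i x - f j y|) {t : ℝ} (ht : 0 < t)
    (hsum : 1 ≤ ∑ i ∈ A, c i ^ t) (n : ℕ) :
    ∀ I : Finset (ℝ × ℝ), I.card ≤ n → IsBallCover K I → (η / 2) ^ t ≤ ∑ p ∈ I, p.2 ^ t := by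
  classical
  induction n with
  | zero =>
    intro I hI hcov
    obtain ⟨x, hx⟩ := hK
    have := hcov.cover hx
    simp [Finset.card_eq_zero.1 (Nat.le_zero.1 hI)] at this
  | succ n ih =>
    intro I hI hcov
    -- A ball of radius at least `η / 2` suffices alone. Otherwise each ball meets at most one copy,
    -- and the cover splits into covers of the separate copies.
    by_cases hbig : ∃ p ∈ I, η / 2 ≤ p.2
    · obtain ⟨p, hp, hpη⟩ := hbig
      exact (Real.rpow_le_rpow (by positivity) hpη ht.le).trans
        (Finset.single_le_sum (f := fun p : ℝ × ℝ => p.2 ^ t)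
          (fun q hq => Real.rpow_nonneg (hcov.pos q hq).le _) hp)
    push Not at hbig
    let J : ι → Finset (ℝ × ℝ) := fun i => I.filter fun p => ∃ x ∈ K, f i x ∈ ball p.1 p.2
    have hJdisj : ∀ i ∈ A, ∀ j ∈ A, i ≠ j → Disjoint (J i) (J j) := by
      intro i hi j hj hij
      rw [Finset.disjoint_left]
      intro p hp hp'
      obtain ⟨hpI, x, hx, hxp⟩ := Finset.mem_filter.1 hp
      obtain ⟨-, y, hy, hyp⟩ := Finset.mem_filter.1 hp'
      have h1 := hsep i hi j hj hij x hx y hy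
      have h2 := hbig p hpI
      rw [mem_ball] at hxp hyp
      have h3 := dist_triangle_right (f i x) (f j y) p.1
      rw [Real.dist_eq (f i x) (f j y)] at h3
      linarith
    have hJne : ∀ i ∈ A, (J i).Nonempty := by
      intro i hi
      obtain ⟨x, hx⟩ := hK
      obtain ⟨p, hp, hxp⟩ := mem_iUnion₂.1 (hcov.cover (hfK i hi hx))
      exact ⟨p, Finset.mem_filter.2 ⟨hp, x, hx, hxp⟩⟩
    -- The part covering copy `i` is a proper subfamily because a second copy needs balls of its
    -- own; this drives the induction on the number of balls.
    have hJcard : ∀ i ∈ A, (J i).card ≤ n := by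
      intro i hi
      obtain ⟨j, hj, hji⟩ := Finset.exists_mem_ne hA i
      obtain ⟨p, hp⟩ := hJne j hj
      have hlt : J i ⊂ I := by
        refine (Finset.filter_subset _ _).ssubset_of_mem_notMem (Finset.mem_filter.1 hp).1
          fun h => Finset.disjoint_left.1 (hJdisj i hi j hj hji.symm) h hp
      have := Finset.card_lt_card hlt
      omega
    -- Pulling the cover of copy `i` back by `f i` divides the radii by `c i` and gives a smaller
    -- cover of `K` itself.
    have hone : ∀ i ∈ A, c i ^ t * (η / 2) ^ t ≤ ∑ p ∈ J i, p.2 ^ t := by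
      intro i hi
      have hci := hc i hi
      obtain ⟨g, hg⟩ := (hsurj i hi).hasRightInverse
      let φ : ℝ × ℝ → ℝ × ℝ := fun p => (g p.1, p.2 / c i)
      have hφ : Function.Injective φ := by
        rintro ⟨a, b⟩ ⟨a', b'⟩ h
        simp only [φ, Prod.mk.injEq] at h ⊢
        exact ⟨hg.injective h.1, by have := h.2; field_simp at this; exact this⟩
      have hcov' : IsBallCover K ((J i).image φ) := by
        refine ⟨fun p hp => ?_, fun x hx => ?_⟩
        · obtain ⟨q, hq, rfl⟩ := Finset.mem_image.1 hp
          exact div_pos (hcov.pos q (Finset.mem_filter.1 hq).1) hci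
        · obtain ⟨p, hp, hxp⟩ := mem_iUnion₂.1 (hcov.cover (hfK i hi hx))
          refine mem_iUnion₂.2 ⟨φ p, Finset.mem_image_of_mem _
            (Finset.mem_filter.2 ⟨hp, x, hx, hxp⟩), ?_⟩
          have := hf i hi x (g p.1)
          rw [hg] at this
          rw [mem_ball, Real.dist_eq] at hxp ⊢
          rw [lt_div_iff₀ hci]
          linarith
      have := ih _ (Finset.card_image_le.trans (hJcard i hi)) hcov'
      rw [Finset.sum_image fun x _ y _ h => hφ h] at this
      have h2 : ∑ p ∈ J i, (φ p).2 ^ t = (∑ p ∈ J i, p.2 ^ t) / c i ^ t := by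
        rw [Finset.sum_div]
        exact Finset.sum_congr rfl fun p hp =>
          Real.div_rpow (hcov.pos p (Finset.mem_filter.1 hp).1).le hci.le _
      rw [h2, le_div_iff₀ (by positivity)] at this
      linarith
    calc (η / 2) ^ t ≤ (∑ i ∈ A, c i ^ t) * (η / 2) ^ t :=
          le_mul_of_one_le_left (by positivity) hsum
      _ ≤ ∑ i ∈ A, ∑ p ∈ J i, p.2 ^ t := by
          rw [Finset.sum_mul]; exact Finset.sum_le_sum hone
      _ = ∑ p ∈ A.biUnion J, p.2 ^ t := by
          rw [Finset.sum_biUnion fun i hi j hj hij => hJdisj i hi j hj hij]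
      _ ≤ ∑ p ∈ I, p.2 ^ t :=
          Finset.sum_le_sum_of_subset_of_nonneg
            (Finset.biUnion_subset.2 fun i _ => Finset.filter_subset _ _)
            fun p hp _ => Real.rpow_nonneg (hcov.pos p hp).le _

theorem exists_pos_forall_le_abs_sub {ι : Type*} {A : Finset ι} {E : ι → Set ℝ}
    (hE : ∀ i ∈ A, IsCompact (E i)) (hdisj : ∀ i ∈ A, ∀ j ∈ A, i ≠ j → Disjoint (E i) (E j)) :
    ∃ η : ℝ, 0 < η ∧ ∀ i ∈ A, ∀ j ∈ A, i ≠ j → ∀ x ∈ E i, ∀ y ∈ E j, η ≤ |x - y| := by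
  classical
  have h : ∀ q : ι × ι, ∃ η : ℝ, 0 < η ∧ (q ∈ A ×ˢ A → q.1 ≠ q.2 →
      ∀ x ∈ E q.1, ∀ y ∈ E q.2, η ≤ |x - y|) := by
    intro q
    by_cases hq : q ∈ A ×ˢ A ∧ q.1 ≠ q.2
    · obtain ⟨hq, hne⟩ := hq
      obtain ⟨h1, h2⟩ := Finset.mem_product.1 hq
      obtain ⟨η, hη, h⟩ := (hdisj _ h1 _ h2 hne).exists_thickenings (hE _ h1)
        (hE _ h2).isClosed
      refine ⟨η, hη, fun _ _ x hx y hy => ?_⟩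
      by_contra! hlt
      have hm : y ∈ thickening η (E q.1) :=
        mem_thickening_iff.2 ⟨x, hx, by rwa [dist_comm, Real.dist_eq]⟩
      exact Set.disjoint_left.1 h hm (self_subset_thickening hη _ hy)
    · exact ⟨1, one_pos, fun h1 h2 => absurd ⟨h1, h2⟩ hq⟩
  choose η hη hle using h
  obtain ⟨ε, hε, hεle⟩ : ∃ ε : ℝ, 0 < ε ∧ ∀ q ∈ A ×ˢ A, ε ≤ η q := by
    rcases (A ×ˢ A).eq_empty_or_nonempty with h0 | h0
    · exact ⟨1, one_pos, by simp [h0]⟩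
    · exact ⟨(A ×ˢ A).inf' h0 η, (Finset.lt_inf'_iff h0).2 fun q _ => hη q,
        fun q hq => Finset.inf'_le _ hq⟩
  refine ⟨ε, hε, fun i hi j hj hij x hx y hy => ?_⟩
  have hm := Finset.mk_mem_product hi hj
  exact (hεle _ hm).trans (hle (i, j) hm hij x hx y hy)

/-- Pairwise disjoint similar copies of a compact set inside itself satisfy `∑ cᵢ ^ s ≤ 1`,
where `s` is the Hausdorff dimension of the set. -/
theorem sum_rpow_le_one_of_pairwise_disjoint {ι : Type*} {K : Set ℝ} (hK : K.Nonempty)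
    (hKc : IsCompact K) {s : ℝ≥0} (hs : dimH K = s) {A : Finset ι} {f : ι → ℝ → ℝ} {c : ι → ℝ}
    (hc : ∀ i ∈ A, 0 < c i) (hc1 : ∀ i ∈ A, c i ≤ 1)
    (hf : ∀ i ∈ A, ∀ x y, |f i x - f i y| = c i * |x - y|) (hsurj : ∀ i ∈ A, (f i).Surjective)
    (hfK : ∀ i ∈ A, MapsTo (f i) K K)
    (hdisj : ∀ i ∈ A, ∀ j ∈ A, i ≠ j → Disjoint (f i '' K) (f j '' K)) :
    ∑ i ∈ A, c i ^ (s : ℝ) ≤ 1 := by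
  by_contra! hlt
  have hA : 1 < A.card := by
    by_contra! hA
    have : ∑ i ∈ A, c i ^ (s : ℝ) ≤ ∑ i ∈ A, (1 : ℝ) :=
      Finset.sum_le_sum fun i hi => Real.rpow_le_one (hc i hi).le (hc1 i hi) s.2
    simp only [Finset.sum_const, nsmul_eq_mul, mul_one] at this
    have h2 : (A.card : ℝ) ≤ 1 := by exact_mod_cast hA
    linarith
  have hcont : ContinuousAt (fun t : ℝ => ∑ i ∈ A, c i ^ t) s :=
    tendsto_finsetSum _ fun i hi =>
      (Real.continuousAt_const_rpow (hc i hi).ne').tendsto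
  -- A strict inequality at `s` survives at some `t > s`, where the previous bound makes the
  -- `t`-dimensional measure positive.
  have h1 : ∀ᶠ t in 𝓝[>] (s : ℝ), 1 < ∑ i ∈ A, c i ^ t :=
    (hcont.tendsto.mono_left nhdsWithin_le_nhds).eventually_const_lt hlt
  obtain ⟨t, ht, hst⟩ := (h1.and self_mem_nhdsWithin).exists
  have hst : (s : ℝ) < t := hst
  have ht0 : 0 < t := s.2.trans_lt hst
  obtain ⟨η, hη, hsep⟩ := exists_pos_forall_le_abs_sub (E := fun i => f i '' K)
    (fun i hi => hKc.image (LipschitzWith.of_dist_le_mul (K := ⟨c i, (hc i hi).le⟩)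
      fun x y => (hf i hi x y).le).continuous) hdisj
  have hpos : μH[t] K ≠ 0 := by
    intro h0
    obtain ⟨I, hI, hIs⟩ := exists_isBallCover_of_hausdorffMeasure_eq_zero hKc ht0 h0
      (ε := (η / 2) ^ t) (by positivity)
    exact hIs.not_ge (le_sum_of_isBallCover hK hA hc hf hsurj hfK hη
      (fun i hi j hj hij x hx y hy => hsep i hi j hj hij _ (mem_image_of_mem _ hx) _
        (mem_image_of_mem _ hy)) ht0 ht.le _ I le_rfl hI)
  lift t to ℝ≥0 using ht0.le
  have := le_dimH_of_hausdorffMeasure_ne_zero hpos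
  rw [hs, ENNReal.coe_le_coe] at this
  exact this.not_gt (NNReal.coe_lt_coe.1 hst)

/-! ### Covering numbers -/

theorem coverNumber_le_card {ι : Type*} {E : Set ℝ} {r : ℝ} (A : Finset ι) (U : ι → Set ℝ)
    (hU : ∀ i ∈ A, IsOpen (U i) ∧ ediam (U i) ≤ ENNReal.ofReal r) (hE : E ⊆ ⋃ i ∈ A, U i) :
    coverNumber r E ≤ A.card := by
  classical
  refine (iInf₂_le_of_le (↑(A.image U)) ?_ (iInf_le_of_le ?_ le_rfl)).trans ?_
  · intro W hW
    obtain ⟨i, hi, rfl⟩ := Finset.mem_image.1 (Finset.mem_coe.1 hW)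
    exact hU i hi
  · intro x hx
    obtain ⟨i, hi, hxi⟩ := mem_iUnion₂.1 (hE hx)
    exact ⟨U i, Finset.mem_coe.2 (Finset.mem_image_of_mem _ hi), hxi⟩
  · rw [Set.encard_coe_eq_coe_finsetCard]
    exact_mod_cast Finset.card_image_le

/-- An infimum of extended naturals is attained, so a finite covering number comes with an optimal
finite cover. -/
theorem exists_finset_of_coverNumber_ne_top {E : Set ℝ} {r : ℝ} (h : coverNumber r E ≠ ⊤) :
    ∃ 𝒰 : Finset (Set ℝ), (∀ U ∈ 𝒰, IsOpen U ∧ ediam U ≤ ENNReal.ofReal r) ∧ E ⊆ ⋃ U ∈ 𝒰, U ∧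
      (𝒰.card : ℕ∞) = coverNumber r E := by
  let T := {𝒰 : Set (Set ℝ) // (∀ U ∈ 𝒰, IsOpen U ∧ ediam U ≤ ENNReal.ofReal r) ∧ E ⊆ ⋃₀ 𝒰}
  have hT : coverNumber r E = ⨅ 𝒰 : T, 𝒰.1.encard := by
    simp only [coverNumber, T, iInf_subtype, iInf_and]
  have hne : Nonempty T := by
    by_contra hne
    rw [not_nonempty_iff] at hne
    rw [hT, iInf_of_empty] at h
    exact h rfl
  obtain ⟨𝒰, h𝒰⟩ := ENat.exists_eq_iInf fun 𝒰 : T => 𝒰.1.encard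
  have hfin : 𝒰.1.Finite := by
    rw [← Set.encard_ne_top_iff, h𝒰, ← hT]; exact h
  refine ⟨hfin.toFinset, fun U hU => 𝒰.2.1 U (hfin.mem_toFinset.1 hU), ?_, ?_⟩
  · intro x hx
    obtain ⟨U, hU, hxU⟩ := 𝒰.2.2 hx
    exact mem_iUnion₂.2 ⟨U, hfin.mem_toFinset.2 hU, hxU⟩
  · rw [hT, ← h𝒰, hfin.encard_eq_coe_toFinset_card]

theorem coverNumber_mono {E E' : Set ℝ} {r r' : ℝ} (hE : E ⊆ E') (hr : r' ≤ r) :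
    coverNumber r E ≤ coverNumber r' E' := by
  by_cases h : coverNumber r' E' = ⊤
  · rw [h]; exact le_top
  obtain ⟨𝒰, h1, h2, h3⟩ := exists_finset_of_coverNumber_ne_top h
  rw [← h3]
  exact coverNumber_le_card 𝒰 id
    (fun U hU => ⟨(h1 U hU).1, (h1 U hU).2.trans (ENNReal.ofReal_le_ofReal hr)⟩) (hE.trans h2)

theorem coverNumber_biUnion_le {ι : Type*} (A : Finset ι) (E : ι → Set ℝ) (r : ℝ) :
    coverNumber r (⋃ i ∈ A, E i) ≤ ∑ i ∈ A, coverNumber r (E i) := by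
  classical
  by_cases h : ∃ i ∈ A, coverNumber r (E i) = ⊤
  · obtain ⟨i, hi, h⟩ := h
    calc _ ≤ (⊤ : ℕ∞) := le_top
      _ = coverNumber r (E i) := h.symm
      _ ≤ _ := Finset.single_le_sum_of_canonicallyOrdered hi (f := fun i => coverNumber r (E i))
  push Not at h
  have h' : ∀ i, ∃ 𝒰 : Finset (Set ℝ), i ∈ A →
      (∀ U ∈ 𝒰, IsOpen U ∧ ediam U ≤ ENNReal.ofReal r) ∧ E i ⊆ ⋃ U ∈ 𝒰, U ∧
      (𝒰.card : ℕ∞) = coverNumber r (E i) := by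
    intro i
    by_cases hi : i ∈ A
    · obtain ⟨𝒰, hU⟩ := exists_finset_of_coverNumber_ne_top (h i hi)
      exact ⟨𝒰, fun _ => hU⟩
    · exact ⟨∅, fun h => absurd h hi⟩
  choose 𝒰 h𝒰 using h'
  calc coverNumber r (⋃ i ∈ A, E i) ≤ ((A.biUnion 𝒰).card : ℕ∞) := by
        refine coverNumber_le_card _ id (fun U hU => ?_) fun x hx => ?_
        · obtain ⟨i, hi, hU⟩ := Finset.mem_biUnion.1 hU
          exact (h𝒰 i hi).1 U hU
        · obtain ⟨i, hi, hx⟩ := mem_iUnion₂.1 hx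
          obtain ⟨U, hU, hx⟩ := mem_iUnion₂.1 ((h𝒰 i hi).2.1 hx)
          exact mem_iUnion₂.2 ⟨U, Finset.mem_biUnion.2 ⟨i, hi, hU⟩, hx⟩
    _ ≤ ((∑ i ∈ A, (𝒰 i).card : ℕ) : ℕ∞) := by exact_mod_cast Finset.card_biUnion_le
    _ = _ := by
        rw [Nat.cast_sum]
        exact Finset.sum_congr rfl fun i hi => (h𝒰 i hi).2.2

/-- Preimages under a similarity of ratio `c` rescale covering numbers. -/
theorem coverNumber_preimage_le {E E' : Set ℝ} {f : ℝ → ℝ} {c r : ℝ} (hc : 0 < c)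
    (hf : ∀ x y, |f x - f y| = c * |x - y|) (hE : MapsTo f E E') :
    coverNumber r E ≤ coverNumber (c * r) E' := by
  by_cases h : coverNumber (c * r) E' = ⊤
  · rw [h]; exact le_top
  obtain ⟨𝒰, h1, h2, h3⟩ := exists_finset_of_coverNumber_ne_top h
  rw [← h3]
  have hcont : Continuous f := (LipschitzWith.of_dist_le_mul (K := ⟨c, hc.le⟩)
      fun x y => (hf x y).le).continuous
  refine coverNumber_le_card 𝒰 (fun U => f ⁻¹' U) (fun U hU => ⟨(h1 U hU).1.preimage hcont, ?_⟩)
    fun x hx => ?_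
  · refine ediam_le fun x hx y hy => ?_
    have h4 := (edist_le_ediam_of_mem (s := U) hx hy).trans (h1 U hU).2
    rw [edist_dist, Real.dist_eq] at h4 ⊢
    rcases le_or_gt (c * r) 0 with hr | hr
    · rw [ENNReal.ofReal_of_nonpos hr, nonpos_iff_eq_zero, ENNReal.ofReal_eq_zero, hf] at h4
      have : |x - y| ≤ 0 := by
        by_contra! h5
        exact (mul_pos hc h5).not_ge h4
      rw [ENNReal.ofReal_of_nonpos this]
      exact zero_le
    · rw [ENNReal.ofReal_le_ofReal_iff hr.le, hf] at h4
      exact ENNReal.ofReal_le_ofReal (le_of_mul_le_mul_left h4 hc)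
  · obtain ⟨U, hU, hx⟩ := mem_iUnion₂.1 (h2 (hE hx))
    exact mem_iUnion₂.2 ⟨U, hU, hx⟩

/-- Images under a similarity of ratio `c` rescale covering numbers. -/
theorem coverNumber_image_le {E : Set ℝ} {f : ℝ → ℝ} {c r : ℝ} (hc : 0 < c)
    (hf : ∀ x y, |f x - f y| = c * |x - y|) (hsurj : f.Surjective) :
    coverNumber r (f '' E) ≤ coverNumber (r / c) E := by
  obtain ⟨g, hg⟩ := hsurj.hasRightInverse
  have hinj : f.Injective := fun x y hxy => by
    have := hf x y
    rw [hxy, sub_self, abs_zero, eq_comm, mul_eq_zero, abs_eq_zero, sub_eq_zero] at this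
    exact this.resolve_left hc.ne'
  have := coverNumber_preimage_le (E := f '' E) (E' := E) (f := g) (r := r) (inv_pos.2 hc)
    (fun x y => by
      have := hf (g x) (g y)
      rw [hg, hg] at this
      rw [this, inv_mul_cancel_left₀ hc.ne'])
    (by
      rintro _ ⟨x, hx, rfl⟩
      rwa [hinj (hg (f x))])
  rwa [inv_mul_eq_div] at this

/-- An optimal cover at scale `r` has `t`-weight at most `C * r ^ (-t) * r ^ t = C`. -/
theorem hausdorffMeasure_ne_top_of_coverNumber_le {E : Set ℝ} {t : ℝ} (ht : 0 ≤ t) {C : ℝ}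
    (h : ∀ r : ℝ, 0 < r → r < 1 → (coverNumber r E : ℝ≥0∞) ≤ ENNReal.ofReal (C * r ^ (-t))) :
    μH[t] E ≠ ⊤ := by
  have hpos : ∀ n : ℕ, (0 : ℝ) < 1 / (n + 2 : ℝ) := fun n => by positivity
  have hlt : ∀ n : ℕ, 1 / (n + 2 : ℝ) < 1 := fun n => by
    rw [div_lt_one (by positivity)]; linarith [n.cast_nonneg (α := ℝ)]
  have hne : ∀ n : ℕ, coverNumber (1 / (n + 2 : ℝ)) E ≠ ⊤ := fun n h0 => by
    have := h _ (hpos n) (hlt n)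
    rw [h0] at this
    simp at this
  choose 𝒰 h1 h2 h3 using fun n : ℕ => exists_finset_of_coverNumber_ne_top (hne n)
  have hlim : Tendsto (fun n : ℕ => (1 / (n + 2 : ℝ))) atTop (𝓝 0) :=
    tendsto_const_nhds.div_atTop
      (tendsto_atTop_add_const_right _ _ tendsto_natCast_atTop_atTop)
  have key := Measure.hausdorffMeasure_le_liminf_sum (ι := fun n => 𝒰 n) t E (l := atTop)
    (fun n : ℕ => ENNReal.ofReal (1 / (n + 2 : ℝ))) (by simpa using ENNReal.tendsto_ofReal hlim)
    (fun n U => U.1) (Eventually.of_forall fun n U => (h1 n U.1 U.2).2)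
    (Eventually.of_forall fun n x hx => by
      obtain ⟨U, hU, hx⟩ := mem_iUnion₂.1 (h2 n hx)
      exact mem_iUnion.2 ⟨⟨U, hU⟩, hx⟩)
  refine ne_top_of_le_ne_top (b := ENNReal.ofReal C) ENNReal.ofReal_ne_top (key.trans ?_)
  have hle : ∀ n : ℕ, ∑ U : 𝒰 n, ediam U.1 ^ t ≤ ENNReal.ofReal C := by
    intro n
    have h4 := h _ (hpos n) (hlt n)
    rw [← h3 n] at h4
    calc ∑ U : 𝒰 n, ediam U.1 ^ t ≤ ∑ U : 𝒰 n, ENNReal.ofReal ((1 / (n + 2 : ℝ)) ^ t) := by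
          refine Finset.sum_le_sum fun U _ => ?_
          rw [← ENNReal.ofReal_rpow_of_nonneg (hpos n).le ht]
          exact ENNReal.rpow_le_rpow (h1 n U.1 U.2).2 ht
      _ = ((𝒰 n).card : ℝ≥0∞) * ENNReal.ofReal ((1 / (n + 2 : ℝ)) ^ t) := by simp
      _ ≤ ENNReal.ofReal (C * (1 / (n + 2 : ℝ)) ^ (-t)) * ENNReal.ofReal ((1 / (n + 2 : ℝ)) ^ t) := by
          gcongr
          exact_mod_cast h4
      _ = ENNReal.ofReal C := by
          rw [← ENNReal.ofReal_mul' (by positivity), mul_assoc, ← Real.rpow_add (hpos n),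
            neg_add_cancel, Real.rpow_zero, mul_one]
  exact (liminf_le_liminf (Eventually.of_forall hle)).trans (by simp)

theorem dimH_le_dimAssouad {E : Set ℝ} (hE : E ⊆ Icc 0 1) : dimH E ≤ dimAssouad E := by
  refine le_iInf₂ fun t ht => ?_
  obtain ⟨C, hC, h⟩ := ht
  rcases E.eq_empty_or_nonempty with rfl | ⟨x, hx⟩
  · simp
  refine dimH_le_of_hausdorffMeasure_ne_top
    (hausdorffMeasure_ne_top_of_coverNumber_le t.2 (C := C * 2 ^ (t : ℝ)) fun r hr hr1 => ?_)
  -- At radius 2 the local covering bound becomes a global one.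
  have hball : ball x 2 ∩ E = E := inter_eq_right.2 fun y hy => by
    rw [mem_ball, Real.dist_eq, abs_lt]
    constructor <;> linarith [(hE hx).1, (hE hx).2, (hE hy).1, (hE hy).2]
  have := h 2 two_pos r hr (by linarith) x hx
  rw [hball] at this
  refine this.trans_eq ?_
  rw [Real.div_rpow two_pos.le hr.le, Real.rpow_neg hr.le]
  congr 1
  rw [div_eq_mul_inv]
  ring

theorem dimAssouad_le_one (E : Set ℝ) : dimAssouad E ≤ 1 := by
  -- Balls on a grid of step `r / 2` use at most `2 * (2 * R / r + 1) + 1 ≤ 7 * (R / r)` centres, as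
  -- `R / r > 1`.
  refine iInf₂_le (1 : ℝ≥0) ⟨7, by norm_num, fun R hR r hr hrR x _ => ?_⟩
  let n : ℤ := ⌊2 * R / r + 1⌋
  have hn0 : 0 ≤ n := Int.floor_nonneg.2 (by positivity)
  have hn : (n : ℝ) ≤ 2 * R / r + 1 := Int.floor_le _
  have hcard : coverNumber r (ball x R ∩ E) ≤ ((Finset.Icc (-n) n).card : ℕ∞) := by
    refine coverNumber_le_card _ (fun k : ℤ => ball (x + k * (r / 2)) (r / 2))
      (fun k _ => ⟨isOpen_ball, (ediam_ball_le _ _).trans_eq (by ring_nf)⟩) fun y hy => ?_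
    have hy1 := hy.1
    rw [mem_ball, Real.dist_eq] at hy1
    have hr2 : (y - x) / (r / 2) * (r / 2) = y - x := by field_simp
    have h1 := abs_sub_round ((y - x) / (r / 2))
    set k := round ((y - x) / (r / 2))
    have h2 : |(y - x) / (r / 2)| ≤ 2 * R / r := by
      rw [abs_div, abs_of_pos (half_pos hr), div_le_div_iff₀ (by positivity) hr]
      nlinarith
    refine mem_iUnion₂.2 ⟨k, ?_, ?_⟩
    · have h3 : |(k : ℝ)| ≤ 2 * R / r + 1 := by
        rw [abs_le] at *
        constructor <;> linarith [h1.1, h1.2, h2.1, h2.2]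
      have h4 : |k| ≤ n := Int.le_floor.2 (by rwa [Int.cast_abs])
      rw [Finset.mem_Icc]
      exact abs_le.1 h4
    · rw [mem_ball, Real.dist_eq]
      have : y - (x + k * (r / 2)) = ((y - x) / (r / 2) - k) * (r / 2) := by
        rw [sub_mul, hr2]; ring
      rw [this, abs_mul, abs_of_pos (half_pos hr)]
      nlinarith
  have hreal : ((Finset.Icc (-n) n).card : ℝ) ≤ 7 * (R / r) ^ ((1 : ℝ≥0) : ℝ) := by
    rw [Int.card_Icc, NNReal.coe_one, Real.rpow_one]
    have h1 : (((n + 1 - -n).toNat : ℤ) : ℝ) = n + 1 - -n := by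
      rw [Int.toNat_of_nonneg (by omega)]; push_cast; ring
    have h2 : 1 ≤ R / r := (one_le_div hr).2 hrR.le
    rw [Int.cast_natCast] at h1
    rw [h1]
    have : 2 * R / r = 2 * (R / r) := by ring
    linarith
  calc (coverNumber r (ball x R ∩ E) : ℝ≥0∞) ≤ (((Finset.Icc (-n) n).card : ℕ∞) : ℝ≥0∞) := by
        exact_mod_cast hcard
    _ = ENNReal.ofReal ((Finset.Icc (-n) n).card : ℝ) := by simp
    _ ≤ _ := ENNReal.ofReal_le_ofReal hreal

/-- Subtracting the squared distances of `f x` from `f 0` and from `f 1` leaves an equation linear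
in `f x`. -/
theorem eq_add_mul_of_similarity {f : ℝ → ℝ} {c : ℝ} (hc : 0 < c)
    (hf : ∀ x y, |f x - f y| = c * |x - y|) (x : ℝ) :
    f x = f 0 + (f 1 - f 0) * x ∧ |f 1 - f 0| = c := by
  have h0 : |f 1 - f 0| = c := by simpa using hf 1 0
  refine ⟨?_, h0⟩
  have h1 : (f x - f 0) ^ 2 = (c * (x - 0)) ^ 2 := by
    rw [← sq_abs, hf, mul_pow, sq_abs, mul_pow]
  have h2 : (f x - f 1) ^ 2 = (c * (x - 1)) ^ 2 := by
    rw [← sq_abs, hf, mul_pow, sq_abs, mul_pow]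
  have h3 : (f 1 - f 0) ^ 2 = c ^ 2 := by rw [← sq_abs, h0]
  have hne : f 1 - f 0 ≠ 0 := abs_pos.1 (h0 ▸ hc)
  have h4 : 2 * (f 1 - f 0) * (f x - f 0 - (f 1 - f 0) * x) = 0 := by
    linear_combination h1 - h2 + (1 - 2 * x) * h3
  have h5 := (mul_eq_zero.1 h4).resolve_left (mul_ne_zero two_ne_zero hne)
  linarith

theorem exists_pos_forall_le {ι : Type*} [Finite ι] (f : ι → ℝ) (hf : ∀ i, 0 < f i) :
    ∃ m, 0 < m ∧ m ≤ 1 ∧ ∀ i, m ≤ f i := by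
  rcases isEmpty_or_nonempty ι with h | h
  · exact ⟨1, one_pos, le_rfl, fun i => h.elim i⟩
  · obtain ⟨i, hi⟩ := Finite.exists_min f
    exact ⟨min 1 (f i), lt_min one_pos (hf i), min_le_left _ _,
      fun j => (min_le_right _ _).trans (hi j)⟩

/-- If `r / 3`-separated finite subsets of `E` have at most `N` elements, then so have
suitable covers of `E` by sets of diameter at most `r`. -/
theorem coverNumber_le_of_separated {E : Set ℝ} {r N : ℝ} (hr : 0 < r)
    (h : ∀ A : Finset ℝ, ↑A ⊆ E → (∀ a ∈ A, ∀ b ∈ A, a ≠ b → r / 3 ≤ |a - b|) → A.card ≤ N) :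
    (coverNumber r E : ℝ≥0∞) ≤ ENNReal.ofReal N := by
  classical
  let P : ℕ → Prop := fun n => ∃ A : Finset ℝ, ↑A ⊆ E ∧
    (∀ a ∈ A, ∀ b ∈ A, a ≠ b → r / 3 ≤ |a - b|) ∧ A.card = n
  have hP0 : P 0 := ⟨∅, by simp⟩
  have hPle : ∀ n, P n → n ≤ ⌊N⌋₊ := by
    rintro n ⟨A, h1, h2, rfl⟩
    exact Nat.le_floor (h A h1 h2)
  -- A separated set of maximal size: a point at distance `r / 2` or more from all of it could be
  -- added.
  obtain ⟨A, hAE, hAs, hAc⟩ : P (Nat.findGreatest P ⌊N⌋₊) := Nat.findGreatest_spec (Nat.zero_le _) hP0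
  have hcov : coverNumber r E ≤ (A.card : ℕ∞) := by
    refine coverNumber_le_card A (fun a => ball a (r / 2))
      (fun a _ => ⟨isOpen_ball, (ediam_ball_le _ _).trans_eq (by ring_nf)⟩) fun y hy => ?_
    by_contra hcon
    have hfar : ∀ a ∈ A, r / 2 ≤ |y - a| := by
      intro a ha
      by_contra! hlt
      exact hcon (mem_iUnion₂.2 ⟨a, ha, by rwa [mem_ball, Real.dist_eq]⟩)
    have hyA : y ∉ A := fun hyA => by
      have := hfar y hyA
      rw [sub_self, abs_zero] at this
      linarith
    have : P (A.card + 1) := by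
      refine ⟨insert y A, ?_, ?_, Finset.card_insert_of_notMem hyA⟩
      · rw [Finset.coe_insert]
        exact insert_subset hy hAE
      · intro a ha b hb hab
        rcases Finset.mem_insert.1 ha with rfl | haA <;>
          rcases Finset.mem_insert.1 hb with rfl | hbA
        · exact absurd rfl hab
        · linarith [hfar b hbA]
        · rw [abs_sub_comm]
          linarith [hfar a haA]
        · exact hAs a haA b hbA hab
    have h1 := Nat.le_findGreatest (hPle _ this) this
    omega
  calc (coverNumber r E : ℝ≥0∞) ≤ ((A.card : ℕ∞) : ℝ≥0∞) := by exact_mod_cast hcov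
    _ = ENNReal.ofReal (A.card : ℝ) := by simp
    _ ≤ _ := ENNReal.ofReal_le_ofReal (h A hAE hAs)

/-! ### Slopes of paths and copies of prescribed size -/

variable {V : Type*} [Quiver V] {S : ∀ u v : V, (u ⟶ v) → ℝ → ℝ} {F : V → Set ℝ}

/-- The slope of the affine map attached to a path. -/
noncomputable def slope (S : ∀ u v : V, (u ⟶ v) → ℝ → ℝ) {u v : V} (p : Quiver.Path u v) : ℝ :=
  pathMap S p 1 - pathMap S p 0

namespace IsSimilaritySystem

theorem abs_slope_pos (hS : IsSimilaritySystem S) {u v : V} (p : Quiver.Path u v) :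
    0 < |slope S p| := by
  obtain ⟨c, hc, h⟩ := hS.exists_ratio p
  rw [slope, (eq_add_mul_of_similarity hc h 0).2]
  exact hc

theorem slope_ne_zero (hS : IsSimilaritySystem S) {u v : V} (p : Quiver.Path u v) :
    slope S p ≠ 0 := abs_pos.1 (hS.abs_slope_pos p)

theorem pathMap_apply (hS : IsSimilaritySystem S) {u v : V} (p : Quiver.Path u v) (x : ℝ) :
    pathMap S p x = pathMap S p 0 + slope S p * x := by
  obtain ⟨c, hc, h⟩ := hS.exists_ratio p
  exact (eq_add_mul_of_similarity hc h x).1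

theorem pathMap_sub (hS : IsSimilaritySystem S) {u v : V} (p : Quiver.Path u v) (x y : ℝ) :
    pathMap S p x - pathMap S p y = slope S p * (x - y) := by
  rw [hS.pathMap_apply p x, hS.pathMap_apply p y]; ring

theorem abs_pathMap_sub (hS : IsSimilaritySystem S) {u v : V} (p : Quiver.Path u v) (x y : ℝ) :
    |pathMap S p x - pathMap S p y| = |slope S p| * |x - y| := by
  rw [hS.pathMap_sub, abs_mul]

theorem slope_comp (hS : IsSimilaritySystem S) {u v w : V} (p : Quiver.Path u v)
    (q : Quiver.Path v w) : slope S (p.comp q) = slope S q * slope S p := by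
  rw [slope, pathMap_comp, Function.comp_apply, Function.comp_apply, hS.pathMap_sub, slope, slope]

theorem mapsTo_pathMap (hS : IsSimilaritySystem S) {u v : V} (p : Quiver.Path u v) :
    MapsTo (pathMap S p) (Icc 0 1) (Icc 0 1) := by
  induction p with
  | nil => exact mapsTo_id _
  | cons p e ih => exact (hS.mapsTo e).comp ih

theorem abs_slope_le_one (hS : IsSimilaritySystem S) {u v : V} (p : Quiver.Path u v) :
    |slope S p| ≤ 1 := by
  have h1 := hS.mapsTo_pathMap p (right_mem_Icc.2 zero_le_one)
  have h0 := hS.mapsTo_pathMap p (left_mem_Icc.2 zero_le_one)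
  rw [slope, abs_le]
  constructor <;> linarith [h1.1, h1.2, h0.1, h0.2]

theorem abs_slope_toPath_lt_one (hS : IsSimilaritySystem S) {u v : V} (e : u ⟶ v) :
    |slope S e.toPath| < 1 := by
  obtain ⟨c, hc, hc1, h⟩ := hS.similarity e
  have : slope S e.toPath = S u v e 1 - S u v e 0 := rfl
  rw [this, (eq_add_mul_of_similarity hc h 0).2]
  exact hc1

end IsSimilaritySystem

theorem IsAttractorFamily.mapsTo_pathMap (hF : IsAttractorFamily S F) {u v : V}
    (p : Quiver.Path u v) : MapsTo (pathMap S p) (F u) (F v) := by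
  induction p with
  | nil => exact mapsTo_id _
  | @cons w v p e ih =>
    intro x hx
    rw [hF.eq_iUnion v]
    exact mem_iUnion₂.2 ⟨w, e, mem_image_of_mem _ (ih hx)⟩

/-- Trace an address of `x` backwards from `v` until the ratio first drops to `δ`. The last edge
read overshoots by at most `κ`, the least edge ratio. -/
theorem exists_path_ratio [Finite V] [∀ u v : V, Finite (u ⟶ v)] (hS : IsSimilaritySystem S)
    (hF : IsAttractorFamily S F) :
    ∃ κ, 0 < κ ∧ κ ≤ 1 ∧ ∀ v, ∀ x ∈ F v, ∀ δ, 0 < δ → δ ≤ 1 →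
      ∃ (w : V) (p : Quiver.Path w v), ∃ y ∈ F w, pathMap S p y = x ∧
        κ * δ ≤ |slope S p| ∧ |slope S p| ≤ δ := by
  obtain ⟨κ, hκ, hκ1, hmin⟩ := exists_pos_forall_le
    (fun e : Σ u v : V, (u ⟶ v) => |slope S e.2.2.toPath|) fun e => hS.abs_slope_pos _
  obtain ⟨m, hm, hm1, hmax⟩ := exists_pos_forall_le
    (fun e : Σ u v : V, (u ⟶ v) => 1 - |slope S e.2.2.toPath|)
    fun e => sub_pos.2 (hS.abs_slope_toPath_lt_one _)
  refine ⟨κ, hκ, hκ1, ?_⟩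
  -- Every edge contracts by at least `1 - m`, so `n` bounds the number of edges still to be read.
  have key : ∀ n : ℕ, ∀ v, ∀ x ∈ F v, ∀ δ, (1 - m) ^ n ≤ δ → 0 < δ → δ ≤ 1 →
      ∃ (w : V) (p : Quiver.Path w v), ∃ y ∈ F w, pathMap S p y = x ∧
        κ * δ ≤ |slope S p| ∧ |slope S p| ≤ δ := by
    intro n
    induction n with
    | zero =>
      intro v x hx δ hδ _ hδ1
      obtain rfl : δ = 1 := le_antisymm hδ1 (by simpa using hδ)
      have h1 : slope S (Quiver.Path.nil : Quiver.Path v v) = 1 := by simp [slope, pathMap]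
      exact ⟨v, .nil, x, hx, rfl, by simpa [h1] using hκ1, by simp [h1]⟩
    | succ n ih =>
      intro v x hx δ hδ hδ0 hδ1
      have hx' := hx
      rw [hF.eq_iUnion v] at hx'
      obtain ⟨u, e, y, hy, hyx⟩ := mem_iUnion₂.1 hx'
      have hκe : κ ≤ |slope S e.toPath| := hmin ⟨u, v, e⟩
      have hme : |slope S e.toPath| ≤ 1 - m := by linarith [hmax ⟨u, v, e⟩]
      have hce := hS.abs_slope_pos e.toPath
      rcases le_or_gt |slope S e.toPath| δ with hle | hlt
      · exact ⟨u, e.toPath, y, hy, hyx, by nlinarith, hle⟩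
      -- The edge `e` is the outermost map, so the remaining path must realise the rescaled size.
      · obtain ⟨w, q, z, hz, hzy, h1, h2⟩ := ih u y hy (δ / |slope S e.toPath|) (by
          rw [le_div_iff₀ hce]
          calc (1 - m) ^ n * |slope S e.toPath| ≤ (1 - m) ^ n * (1 - m) := by
                have : 0 ≤ 1 - m := by linarith
                gcongr
            _ ≤ δ := by rwa [← pow_succ]) (by positivity) ((div_le_one hce).2 hlt.le)
        refine ⟨w, q.comp e.toPath, z, hz, ?_, ?_, ?_⟩
        · rw [pathMap_comp, Function.comp_apply, hzy]; exact hyx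
        · rw [hS.slope_comp, abs_mul]
          rw [← mul_div_assoc, div_le_iff₀ hce] at h1
          linarith
        · rw [hS.slope_comp, abs_mul]
          rw [le_div_iff₀ hce] at h2
          linarith
  intro v x hx δ hδ hδ1
  obtain ⟨n, hn⟩ := exists_pow_lt_of_lt_one hδ (show 1 - m < 1 by linarith)
  exact key n v x hx δ hn.le hδ hδ1

theorem exists_connecting_ratio [Finite V] (hV : Quiver.IsStronglyConnected V)
    (hS : IsSimilaritySystem S) :
    ∃ κ, 0 < κ ∧ κ ≤ 1 ∧ ∀ u v : V, ∃ p : Quiver.Path u v, κ ≤ |slope S p| := by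
  have b : ∀ u v : V, Quiver.Path u v := fun u v => (hV u v).some
  obtain ⟨κ, hκ, hκ1, h⟩ := exists_pos_forall_le
    (fun q : V × V => |slope S (b q.1 q.2)|) fun q => hS.abs_slope_pos _
  exact ⟨κ, hκ, hκ1, fun u v => ⟨b u v, h (u, v)⟩⟩

/-- Every point of `F v` is approximated at every scale by similar copies of `F v` whose size
is comparable to the scale. -/
theorem exists_loop_ratio [Finite V] [∀ u v : V, Finite (u ⟶ v)]
    (hV : Quiver.IsStronglyConnected V) (hS : IsSimilaritySystem S)
    (hF : IsAttractorFamily S F) :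
    ∃ κ, 0 < κ ∧ κ ≤ 1 ∧ ∀ v, ∀ x ∈ F v, ∀ δ, 0 < δ → δ ≤ 1 →
      ∃ p : Quiver.Path v v, κ * δ ≤ |slope S p| ∧ |slope S p| ≤ δ ∧
        ∀ z ∈ Icc (0 : ℝ) 1, |pathMap S p z - x| ≤ δ := by
  obtain ⟨κ, hκ, hκ1, h⟩ := exists_path_ratio hS hF
  obtain ⟨κ', hκ', hκ1', h'⟩ := exists_connecting_ratio hV hS
  refine ⟨κ' * κ, mul_pos hκ' hκ, mul_le_one₀ hκ1' hκ.le hκ1, fun v x hx δ hδ hδ1 => ?_⟩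
  -- Starting the path at `v` by a connecting path turns a copy of `F w` into a copy of `F v`,
  -- losing only a fixed factor.
  obtain ⟨w, p, y, hy, hyx, h1, h2⟩ := h v x hx δ hδ hδ1
  obtain ⟨b, hb⟩ := h' v w
  have hb1 := hS.abs_slope_le_one b
  have hb0 := hS.abs_slope_pos b
  have hp0 := hS.abs_slope_pos p
  refine ⟨b.comp p, ?_, ?_, fun z hz => ?_⟩
  · rw [hS.slope_comp, abs_mul]
    calc κ' * κ * δ = (κ * δ) * κ' := by ring
      _ ≤ _ := by gcongr
  · rw [hS.slope_comp, abs_mul]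
    nlinarith
  · rw [pathMap_comp, Function.comp_apply, ← hyx, hS.abs_pathMap_sub]
    have h3 : |pathMap S b z - y| ≤ 1 := by
      have h4 := hS.mapsTo_pathMap b hz
      have h5 := hF.subset w hy
      rw [abs_le]
      constructor <;> linarith [h4.1, h4.2, h5.1, h5.2]
    nlinarith

/-! ### Positive Hausdorff measure bounds the Assouad dimension -/

theorem exists_pos_le_sum_of_hausdorffMeasure_ne_zero {K : Set ℝ} (hK : K.Nonempty) {s : ℝ≥0}
    (h : μH[(s : ℝ)] K ≠ 0) :
    ∃ m : ℝ, 0 < m ∧ ∀ I, IsBallCover K I → m ≤ ∑ p ∈ I, p.2 ^ (s : ℝ) := by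
  -- For `s = 0` the sum just counts balls, and a non-empty set needs at least one.
  rcases eq_or_lt_of_le s.2 with hs | hs
  · refine ⟨1, one_pos, fun I hI => ?_⟩
    obtain ⟨x, hx⟩ := hK
    obtain ⟨p, hp, -⟩ := mem_iUnion₂.1 (hI.cover hx)
    have hs' : (s : ℝ) = 0 := hs.symm
    simp only [hs', Real.rpow_zero, Finset.sum_const, nsmul_eq_mul, mul_one]
    exact_mod_cast Finset.card_pos.2 ⟨p, hp⟩
  · by_contra! hcon
    exact h (hausdorffMeasure_eq_zero_of_isBallCover hs hcon)

/-- Loop copies of a ball, together with disjoint loop copies of `F v` inside that ball, bound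
the total weight of the latter. -/
theorem sum_rpow_slope_le [Finite V] [∀ u v : V, Finite (u ⟶ v)]
    (hV : Quiver.IsStronglyConnected V) (hS : IsSimilaritySystem S) (hF : IsAttractorFamily S F)
    {v : V} {s : ℝ≥0} (hs : dimH (F v) = s) {m : ℝ}
    (hm : ∀ I, IsBallCover (F v) I → m ≤ ∑ p ∈ I, p.2 ^ (s : ℝ)) {ι : Type*} {A : Finset ι}
    (hA : A.Nonempty) (p : ι → Quiver.Path v v) {x R : ℝ} (hx : x ∈ F v) (hR : 0 < R)
    (hdisj : ∀ i ∈ A, ∀ j ∈ A, i ≠ j → Disjoint (pathMap S (p i) '' F v) (pathMap S (p j) '' F v))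
    (hsub : ∀ i ∈ A, pathMap S (p i) '' F v ⊆ closedBall x R) :
    m * ∑ i ∈ A, |slope S (p i)| ^ (s : ℝ) ≤ (2 * R) ^ (s : ℝ) := by
  classical
  have hx01 := hF.subset v hx
  set W := ∑ i ∈ A, |slope S (p i)| ^ (s : ℝ) with hWdef
  have hW : 0 < W := Finset.sum_pos (fun i _ => Real.rpow_pos_of_pos (hS.abs_slope_pos _) _) hA
  obtain ⟨κ, hκ, hκ1, hloop⟩ := exists_loop_ratio hV hS hF
  -- `B q` is the image of `closedBall x R` under the loop `q`, so it contains the copies `q ∘ p i`.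
  let B : Quiver.Path v v → Set ℝ := fun q => closedBall (pathMap S q x) (R * |slope S q|)
  have hBne : ∀ q, (B q).Nonempty := fun q =>
    nonempty_closedBall.2 (mul_nonneg hR.le (abs_nonneg _))
  obtain ⟨u, -, hudisj, hu⟩ := Vitali.exists_disjoint_subfamily_covering_enlargement B univ
    (fun q => |slope S q|) 2 one_lt_two (fun q _ => abs_nonneg _) 1
    (fun q _ => hS.abs_slope_le_one q) (fun q _ => hBne q)
  -- The composites of loops from `J` with the `p i` are disjoint copies of `F v`, and their total
  -- weight factors as the weight of `J` times `W`.
  have hsum : ∀ J : Finset (Quiver.Path v v), ↑J ⊆ u → ∑ q ∈ J, |slope S q| ^ (s : ℝ) ≤ W⁻¹ := by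
    intro J hJ
    have key := sum_rpow_le_one_of_pairwise_disjoint (hF.nonempty v) (hF.isCompact v) hs
      (A := J ×ˢ A) (f := fun q => pathMap S ((p q.2).comp q.1))
      (c := fun q => |slope S ((p q.2).comp q.1)|) (fun _ _ => hS.abs_slope_pos _)
      (fun _ _ => hS.abs_slope_le_one _) (fun _ _ => hS.abs_pathMap_sub _)
      (fun _ _ => (hS.bijective_pathMap _).surjective) (fun _ _ => hF.mapsTo_pathMap _) ?_
    · have h1 : ∑ q ∈ J ×ˢ A, |slope S ((p q.2).comp q.1)| ^ (s : ℝ) =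
          (∑ q ∈ J, |slope S q| ^ (s : ℝ)) * W := by
        rw [hWdef, Finset.sum_mul_sum, Finset.sum_product]
        refine Finset.sum_congr rfl fun q _ => Finset.sum_congr rfl fun i _ => ?_
        rw [hS.slope_comp, abs_mul, Real.mul_rpow (abs_nonneg _) (abs_nonneg _)]
      rw [h1] at key
      rwa [← one_div, le_div_iff₀ hW]
    · rintro ⟨q, i⟩ hqi ⟨q', j⟩ hqj hne
      obtain ⟨hq, hi⟩ := Finset.mem_product.1 hqi
      obtain ⟨hq', hj⟩ := Finset.mem_product.1 hqj
      simp only at hq hi hq' hj ⊢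
      rw [pathMap_comp, pathMap_comp, image_comp, image_comp]
      have hin : ∀ q, ∀ i ∈ A, pathMap S q '' (pathMap S (p i) '' F v) ⊆ B q := by
        rintro q i hi _ ⟨y, hy, rfl⟩
        have h1 := hsub i hi hy
        rw [mem_closedBall, Real.dist_eq] at h1 ⊢
        rw [hS.abs_pathMap_sub, mul_comm]
        gcongr
      by_cases hqq : q = q'
      · subst hqq
        refine disjoint_image_of_injective (hS.bijective_pathMap q).injective
          (hdisj i hi j hj fun hij => hne (by rw [hij]))
      · exact (hudisj (hJ hq) (hJ hq') hqq).mono (hin q i hi) (hin q' j hj)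
  let T : Set ℝ := (fun J : Finset (Quiver.Path v v) => ∑ q ∈ J, |slope S q| ^ (s : ℝ)) ''
    {J | ↑J ⊆ u}
  have hTb : BddAbove T := ⟨W⁻¹, by rintro _ ⟨J, hJ, rfl⟩; exact hsum J hJ⟩
  have hTne : T.Nonempty := ⟨_, ∅, by simp, rfl⟩
  -- If `B q` meets `B b` with `|slope S q| ≤ 2 * |slope S b|`, the point approximated by `q` is
  -- within `(2 / κ + 3 * R) * |slope S b|` of the centre of `B b`.
  let C : ℝ := 2 / κ + 4 * R + 1
  have hC : 0 < C := by positivity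
  have hmain : ∀ ε > 0, m ≤ (2 * R) ^ (s : ℝ) * W⁻¹ + C ^ (s : ℝ) * ε := by
    intro ε hε
    obtain ⟨_, ⟨J₀, hJ₀, rfl⟩, hJ₀s⟩ := exists_lt_of_lt_csSup hTne (sub_lt_self (sSup T) hε)
    have hJ₀ : ↑J₀ ⊆ u := hJ₀
    have htail : ∀ J : Finset (Quiver.Path v v), ↑J ⊆ u → Disjoint J₀ J →
        ∑ q ∈ J, |slope S q| ^ (s : ℝ) ≤ ε := by
      intro J hJ hd
      have h1 : ∑ q ∈ J₀ ∪ J, |slope S q| ^ (s : ℝ) ≤ sSup T :=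
        le_csSup hTb ⟨J₀ ∪ J, by
          show ((J₀ ∪ J : Finset _) : Set _) ⊆ u
          rw [Finset.coe_union]; exact union_subset hJ₀ hJ, rfl⟩
      rw [Finset.sum_union hd] at h1
      simp only at hJ₀s
      linarith
    -- Balls in the finite main part are doubled merely to become open; the costly enlargement by
    -- `C` is confined to the tail of weight at most `ε`.
    let ρ : Quiver.Path v v → ℝ := fun q => if q ∈ J₀ then 2 * R * |slope S q| else C * |slope S q|
    have hρ : ∀ q, 0 < ρ q := fun q => by
      have := hS.abs_slope_pos q
      simp only [ρ]
      split_ifs <;> positivity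
    have hcov : F v ⊆ ⋃ q : Quiver.Path v v, ⋃ _ : q ∈ u, ball (pathMap S q x) (ρ q) := by
      intro y hy
      by_cases hyJ : ∃ q ∈ J₀, y ∈ B q
      · obtain ⟨q, hq, hyq⟩ := hyJ
        refine mem_iUnion₂.2 ⟨q, hJ₀ hq, ?_⟩
        have h0 := hS.abs_slope_pos q
        rw [mem_closedBall] at hyq
        rw [mem_ball]
        simp only [ρ, if_pos hq]
        nlinarith
      -- A point off the closed main part has a loop copy so small that its ball misses that part;
      -- the Vitali ball it meets must then belong to the tail.
      · have hopen : IsOpen (⋃ q ∈ J₀, B q)ᶜ :=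
          (J₀.finite_toSet.isClosed_biUnion fun q _ => isClosed_closedBall).isOpen_compl
        have hyc : y ∈ (⋃ q ∈ J₀, B q)ᶜ := by
          intro h
          obtain ⟨q, hq, h⟩ := mem_iUnion₂.1 h
          exact hyJ ⟨q, hq, h⟩
        obtain ⟨ε', hε', hball⟩ := Metric.isOpen_iff.1 hopen y hyc
        obtain ⟨q, hq1, hq2, hq3⟩ := hloop v y hy (min 1 (ε' / (2 * (1 + R))))
          (lt_min one_pos (by positivity)) (min_le_left _ _)
        set δ := min 1 (ε' / (2 * (1 + R)))
        have hδ : δ * (1 + R) < ε' := by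
          have h1 : δ ≤ ε' / (2 * (1 + R)) := min_le_right _ _
          rw [le_div_iff₀ (by positivity)] at h1
          linarith
        have hqx := hq3 x hx01
        obtain ⟨b, hbu, ⟨z, hzq, hzb⟩, hqb⟩ := hu q (mem_univ _)
        rw [mem_closedBall, Real.dist_eq] at hzq hzb
        have hq0 := hS.abs_slope_pos q
        have hb0 := hS.abs_slope_pos b
        have hbJ : b ∉ J₀ := by
          intro hb
          refine hball (a := z) ?_ (mem_iUnion₂.2 ⟨b, hb, by
            rw [mem_closedBall, Real.dist_eq]; exact hzb⟩)
          rw [mem_ball, Real.dist_eq]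
          have h1 := abs_sub_le z (pathMap S q x) y
          nlinarith
        refine mem_iUnion₂.2 ⟨b, hbu, ?_⟩
        rw [mem_ball, Real.dist_eq]
        simp only [ρ, if_neg hbJ]
        have h1 := abs_sub_le y (pathMap S q x) (pathMap S b x)
        have h2 := abs_sub_le (pathMap S q x) z (pathMap S b x)
        rw [abs_sub_comm] at hqx hzq
        have h3 : δ ≤ 2 / κ * |slope S b| := by
          rw [div_mul_eq_mul_div, le_div_iff₀ hκ]
          linarith
        have h4 : R * |slope S q| ≤ R * (2 * |slope S b|) := by gcongr
        have h5 : C * |slope S b| = 2 / κ * |slope S b| + 4 * (R * |slope S b|) + |slope S b| := by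
          simp only [C]; ring
        have h6 : 0 < R * |slope S b| := by positivity
        linarith
    obtain ⟨J, hJ⟩ := (hF.isCompact v).elim_finite_subcover
      (fun q : Quiver.Path v v => ⋃ _ : q ∈ u, ball (pathMap S q x) (ρ q))
      (fun q => isOpen_iUnion fun _ => isOpen_ball) hcov
    let J' := J.filter (· ∈ u)
    have hJ'u : ∀ q ∈ J', q ∈ u := fun q hq => (Finset.mem_filter.1 hq).2
    have hI : IsBallCover (F v) (J'.image fun q => (pathMap S q x, ρ q)) := by
      refine ⟨fun t ht => ?_, fun y hy => ?_⟩
      · obtain ⟨q, -, rfl⟩ := Finset.mem_image.1 ht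
        exact hρ q
      · obtain ⟨q, hq, hy⟩ := mem_iUnion₂.1 (hJ hy)
        obtain ⟨hqu, hy⟩ := mem_iUnion.1 hy
        exact mem_iUnion₂.2 ⟨(pathMap S q x, ρ q),
          Finset.mem_image_of_mem _ (Finset.mem_filter.2 ⟨hq, hqu⟩), hy⟩
    calc m ≤ ∑ t ∈ J'.image (fun q => (pathMap S q x, ρ q)), t.2 ^ (s : ℝ) := hm _ hI
      _ ≤ ∑ q ∈ J', ρ q ^ (s : ℝ) := Finset.sum_image_le_of_nonneg fun t ht => by
          obtain ⟨q, -, rfl⟩ := Finset.mem_image.1 ht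
          exact Real.rpow_nonneg (hρ q).le _
      _ = ∑ q ∈ J' with q ∈ J₀, ρ q ^ (s : ℝ) + ∑ q ∈ J' with q ∉ J₀, ρ q ^ (s : ℝ) :=
          (Finset.sum_filter_add_sum_filter_not _ _ _).symm
      _ = (2 * R) ^ (s : ℝ) * ∑ q ∈ J' with q ∈ J₀, |slope S q| ^ (s : ℝ) +
          C ^ (s : ℝ) * ∑ q ∈ J' with q ∉ J₀, |slope S q| ^ (s : ℝ) := by
          rw [Finset.mul_sum, Finset.mul_sum]
          congr 1 <;> refine Finset.sum_congr rfl fun q hq => ?_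
          · simp only [ρ, if_pos (Finset.mem_filter.1 hq).2]
            rw [Real.mul_rpow (by positivity) (abs_nonneg _)]
          · simp only [ρ, if_neg (Finset.mem_filter.1 hq).2]
            rw [Real.mul_rpow hC.le (abs_nonneg _)]
      _ ≤ _ := by
          gcongr
          · exact hsum _ fun q hq => hJ'u q (Finset.mem_filter.1 (Finset.mem_coe.1 hq)).1
          · refine htail _ (fun q hq => hJ'u q (Finset.mem_filter.1 (Finset.mem_coe.1 hq)).1) ?_
            rw [Finset.disjoint_left]
            exact fun q hq hq' => (Finset.mem_filter.1 hq').2 hq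
  have hlim : m ≤ (2 * R) ^ (s : ℝ) * W⁻¹ := by
    refine le_of_forall_pos_le_add fun ε hε => ?_
    have hCs : 0 < C ^ (s : ℝ) := Real.rpow_pos_of_pos hC _
    have := hmain (ε / C ^ (s : ℝ)) (by positivity)
    rwa [mul_div_cancel₀ _ hCs.ne'] at this
  rwa [← div_eq_mul_inv, le_div_iff₀ hW] at hlim

/-- If `F v` has positive Hausdorff measure in its dimension `s`, then `r`-separated subsets of
balls of radius `R` have at most `C (R / r) ^ s` elements. -/
theorem exists_card_le_of_separated [Finite V] [∀ u v : V, Finite (u ⟶ v)]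
    (hV : Quiver.IsStronglyConnected V) (hS : IsSimilaritySystem S) (hF : IsAttractorFamily S F)
    {v : V} {s : ℝ≥0} (hs : dimH (F v) = s) (hpos : μH[(s : ℝ)] (F v) ≠ 0) :
    ∃ C : ℝ, 0 < C ∧ ∀ R r : ℝ, 0 < r → r < R → ∀ x ∈ F v, ∀ A : Finset ℝ,
      ↑A ⊆ ball x R ∩ F v → (∀ a ∈ A, ∀ b ∈ A, a ≠ b → r ≤ |a - b|) →
      (A.card : ℝ) ≤ C * (R / r) ^ (s : ℝ) := by
  classical
  obtain ⟨m, hm, hmI⟩ := exists_pos_le_sum_of_hausdorffMeasure_ne_zero (hF.nonempty v) hpos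
  obtain ⟨κ, hκ, hκ1, hloop⟩ := exists_loop_ratio hV hS hF
  -- The restriction `R ≤ 2` keeps `r / 3 ≤ 1`, as loop approximation requires. Copies within `r /
  -- 3` of `r`-separated points are disjoint and lie in the ball of radius `2 * R`; comparing `4 *
  -- R` with `κ * r / 3` gives `12 / κ`.
  have hsmall : ∀ R r : ℝ, 0 < r → r < R → R ≤ 2 → ∀ x ∈ F v, ∀ A : Finset ℝ,
      ↑A ⊆ ball x R ∩ F v → (∀ a ∈ A, ∀ b ∈ A, a ≠ b → r ≤ |a - b|) →
      (A.card : ℝ) ≤ (m⁻¹ * (12 / κ) ^ (s : ℝ)) * (R / r) ^ (s : ℝ) := by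
    intro R r hr hrR hR2 x hx A hA hsep
    have hR : 0 < R := hr.trans hrR
    rcases A.eq_empty_or_nonempty with rfl | hAne
    · simp only [Finset.card_empty, Nat.cast_zero]
      positivity
    have hex : ∀ a, ∃ p : Quiver.Path v v, a ∈ A → κ * (r / 3) ≤ |slope S p| ∧
        ∀ z ∈ Icc (0 : ℝ) 1, |pathMap S p z - a| ≤ r / 3 := by
      intro a
      by_cases ha : a ∈ A
      · obtain ⟨p, h1, -, h2⟩ := hloop v a (hA ha).2 (r / 3) (by positivity) (by linarith)
        exact ⟨p, fun _ => ⟨h1, h2⟩⟩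
      · exact ⟨.nil, fun h => absurd h ha⟩
    choose p hp using hex
    have key := sum_rpow_slope_le hV hS hF hs hmI hAne p hx (R := 2 * R) (by positivity) ?_ ?_
    · have h1 : (A.card : ℝ) * (κ * (r / 3)) ^ (s : ℝ) ≤ ∑ a ∈ A, |slope S (p a)| ^ (s : ℝ) := by
        rw [← nsmul_eq_mul]
        refine Finset.card_nsmul_le_sum _ _ _ fun a ha => ?_
        exact Real.rpow_le_rpow (by positivity) (hp a ha).1 s.2
      have h2 : (2 * (2 * R)) ^ (s : ℝ) = (12 / κ) ^ (s : ℝ) * (R / r) ^ (s : ℝ) *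
          (κ * (r / 3)) ^ (s : ℝ) := by
        rw [← Real.mul_rpow (by positivity) (by positivity),
          ← Real.mul_rpow (by positivity) (by positivity)]
        congr 1
        field_simp
        ring
      have h3 : 0 < (κ * (r / 3)) ^ (s : ℝ) := by positivity
      have h4 : m * ((A.card : ℝ) * (κ * (r / 3)) ^ (s : ℝ)) ≤
          (12 / κ) ^ (s : ℝ) * (R / r) ^ (s : ℝ) * (κ * (r / 3)) ^ (s : ℝ) := by
        rw [← h2]
        exact (mul_le_mul_of_nonneg_left h1 hm.le).trans key
      rw [← mul_assoc] at h4
      have h5 := le_of_mul_le_mul_right h4 h3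
      rw [mul_assoc, inv_mul_eq_div, le_div_iff₀ hm]
      linarith
    · intro a ha b hb hab
      rw [Set.disjoint_left]
      rintro _ ⟨y, hy, rfl⟩ ⟨z, hz, hzy⟩
      have h1 := (hp a ha).2 y (hF.subset v hy)
      have h2 := (hp b hb).2 z (hF.subset v hz)
      rw [hzy] at h2
      have h3 := abs_sub_le a (pathMap S (p a) y) b
      rw [abs_sub_comm a (pathMap S (p a) y)] at h3
      linarith [hsep a ha b hb hab]
    · rintro a ha _ ⟨y, hy, rfl⟩
      have h1 := (hp a ha).2 y (hF.subset v hy)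
      have h2 := (hA ha).1
      rw [mem_ball, Real.dist_eq] at h2
      rw [mem_closedBall, Real.dist_eq]
      linarith [abs_sub_le (pathMap S (p a) y) a x]
  set C := m⁻¹ * (12 / κ) ^ (s : ℝ)
  refine ⟨max C 1, by positivity, fun R r hr hrR x hx A hA hsep => ?_⟩
  have hR : 0 < R := hr.trans hrR
  have hone : 1 ≤ (R / r) ^ (s : ℝ) := Real.one_le_rpow ((one_le_div hr).2 hrR.le) s.2
  -- Larger `R` adds nothing since `F v ⊆ [0, 1]`; for `r ≥ 2` at most one point remains, whence the
  -- `max` with 1.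
  rcases le_or_gt R 2 with hR2 | hR2
  · refine (hsmall R r hr hrR hR2 x hx A hA hsep).trans ?_
    gcongr
    exact le_max_left _ _
  rcases lt_or_ge r 2 with hr2 | hr2
  · have hA' : ↑A ⊆ ball x 2 ∩ F v := fun a ha => by
      have h1 := hF.subset v (hA ha).2
      have h2 := hF.subset v hx
      refine ⟨?_, (hA ha).2⟩
      rw [mem_ball, Real.dist_eq, abs_lt]
      constructor <;> linarith [h1.1, h1.2, h2.1, h2.2]
    refine (hsmall 2 r hr hr2 le_rfl x hx A hA' hsep).trans ?_
    gcongr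
    exact le_max_left _ _
  · have hcard : A.card ≤ 1 := by
      refine Finset.card_le_one.2 fun a ha b hb => ?_
      by_contra hab
      have h1 := hF.subset v (hA ha).2
      have h2 := hF.subset v (hA hb).2
      have h3 : |a - b| ≤ 1 := by
        rw [abs_le]
        constructor <;> linarith [h1.1, h1.2, h2.1, h2.2]
      linarith [hsep a ha b hb hab]
    have hcard' : (A.card : ℝ) ≤ 1 := by exact_mod_cast hcard
    exact hcard'.trans (one_le_mul_of_one_le_of_one_le (le_max_right _ _) hone)

theorem dimAssouad_le_of_hausdorffMeasure_ne_zero [Finite V] [∀ u v : V, Finite (u ⟶ v)]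
    (hV : Quiver.IsStronglyConnected V) (hS : IsSimilaritySystem S) (hF : IsAttractorFamily S F)
    {v : V} {s : ℝ≥0} (hs : dimH (F v) = s) (hpos : μH[(s : ℝ)] (F v) ≠ 0) :
    dimAssouad (F v) ≤ s := by
  obtain ⟨C, hC, h⟩ := exists_card_le_of_separated hV hS hF hs hpos
  refine iInf₂_le s ⟨C * 3 ^ (s : ℝ), by positivity, fun R hR r hr hrR x hx => ?_⟩
  refine coverNumber_le_of_separated hr fun A hA hsep => ?_
  refine (h R (r / 3) (by positivity) (by linarith) x hx A hA hsep).trans_eq ?_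
  rw [mul_assoc, ← Real.mul_rpow (by norm_num) (by positivity)]
  congr 2
  field_simp

/-! ### Quotient maps close to the identity -/

theorem IsSimilaritySystem.invFun_pathMap (hS : IsSimilaritySystem S) {u v : V}
    (p : Quiver.Path u v) (y : ℝ) :
    Function.invFun (pathMap S p) y = (y - pathMap S p 0) / slope S p := by
  have h := Function.rightInverse_invFun (hS.bijective_pathMap p).surjective y
  rw [hS.pathMap_apply] at h
  rw [eq_div_iff (hS.slope_ne_zero p)]
  linarith

theorem IsSimilaritySystem.invFun_comp_pathMap_zero (hS : IsSimilaritySystem S) {u v : V}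
    (p q : Quiver.Path u v) : (Function.invFun (pathMap S p) ∘ pathMap S q) 0 =
      (pathMap S q 0 - pathMap S p 0) / slope S p := by
  rw [Function.comp_apply, hS.invFun_pathMap]

theorem IsSimilaritySystem.invFun_comp_pathMap_one (hS : IsSimilaritySystem S) {u v : V}
    (p q : Quiver.Path u v) : (Function.invFun (pathMap S p) ∘ pathMap S q) 1 - 1 =
      (pathMap S q 1 - pathMap S p 1) / slope S p := by
  have h := hS.slope_ne_zero p
  rw [Function.comp_apply, hS.invFun_pathMap, div_sub_one h]
  congr 1
  rw [slope]
  ring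

theorem IsSimilaritySystem.invFun_comp_pathMap_eq_id_iff (hS : IsSimilaritySystem S) {u v : V}
    (p q : Quiver.Path u v) :
    Function.invFun (pathMap S p) ∘ pathMap S q = id ↔ pathMap S p = pathMap S q := by
  have hp := hS.bijective_pathMap p
  constructor
  · intro h
    funext x
    have h1 := congrArg (pathMap S p) (congrFun h x)
    rw [Function.comp_apply, Function.rightInverse_invFun hp.surjective] at h1
    exact h1.symm
  · intro h
    rw [← h]
    exact Function.invFun_comp hp.injective

/-- Quotient maps are affine, so closeness to the identity can be tested at 0 and 1. Multiplying by
`|slope S p|` removes the inverse. -/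
theorem IsSimilaritySystem.exists_pos_of_idIsolatedAt (hS : IsSimilaritySystem S) {v : V}
    (h : IdIsolatedAt S v) : ∃ ε > 0, ∀ p q : Quiver.Path v v,
      |pathMap S q 0 - pathMap S p 0| < ε * |slope S p| →
      |pathMap S q 1 - pathMap S p 1| < ε * |slope S p| → pathMap S p = pathMap S q := by
  obtain ⟨U, hU, hUQ⟩ := h
  -- An affine map as a continuous function of its values at 0 and 1.
  let Φ : ℝ × ℝ → ℝ → ℝ := fun a x => a.1 + (a.2 - a.1) * x
  have hΦ : Continuous Φ := by fun_prop
  have hid : (id : ℝ → ℝ) ∈ U := by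
    have : (id : ℝ → ℝ) ∈ U ∩ quotientMaps S v v := by rw [hUQ]; rfl
    exact this.1
  have h01 : Φ (0, 1) = id := by funext x; simp [Φ]
  obtain ⟨ε, hε, hball⟩ := Metric.isOpen_iff.1 (hU.preimage hΦ) (0, 1) (by
    rw [mem_preimage, h01]; exact hid)
  refine ⟨ε, hε, fun p q h0 h1 => ?_⟩
  have hp := hS.abs_slope_pos p
  rw [← hS.invFun_comp_pathMap_eq_id_iff]
  set g := Function.invFun (pathMap S p) ∘ pathMap S q with hg
  have hg0 : |g 0| < ε := by
    rwa [hg, hS.invFun_comp_pathMap_zero, abs_div, div_lt_iff₀ hp]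
  have hg1 : |g 1 - 1| < ε := by
    rwa [hg, hS.invFun_comp_pathMap_one, abs_div, div_lt_iff₀ hp]
  have hgΦ : Φ (g 0, g 1) = g := by
    funext x
    simp only [Φ, hg, Function.comp_apply, hS.invFun_pathMap]
    rw [hS.pathMap_apply q x, hS.pathMap_apply q 1]
    field_simp [hS.slope_ne_zero p]
    ring
  have hmem : g ∈ U := by
    rw [← hgΦ]
    refine hball ?_
    rw [mem_ball, Prod.dist_eq, max_lt_iff, Real.dist_eq, Real.dist_eq, sub_zero]
    exact ⟨hg0, hg1⟩
  have : g ∈ U ∩ quotientMaps S v v := ⟨hmem, p, q, hg⟩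
  rwa [hUQ] at this

theorem IsSimilaritySystem.exists_paths_of_not_idIsolatedAt (hS : IsSimilaritySystem S) {v : V}
    (h : ¬ IdIsolatedAt S v) {ε : ℝ} (hε : 0 < ε) : ∃ p q : Quiver.Path v v,
      |pathMap S q 0 - pathMap S p 0| < ε * |slope S p| ∧
      |pathMap S q 1 - pathMap S p 1| < ε * |slope S p| ∧ pathMap S p ≠ pathMap S q := by
  by_contra! hcon
  refine h ⟨{g | |g 0| < ε ∧ |g 1 - 1| < ε}, ?_, ?_⟩
  · have h0 : Continuous fun g : ℝ → ℝ => |g 0| := by fun_prop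
    have h1 : Continuous fun g : ℝ → ℝ => |g 1 - 1| := by fun_prop
    exact (isOpen_lt h0 continuous_const).inter (isOpen_lt h1 continuous_const)
  · ext g
    rw [mem_singleton_iff]
    constructor
    · rintro ⟨⟨h0, h1⟩, p, q, rfl⟩
      have hp := hS.abs_slope_pos p
      rw [hS.invFun_comp_pathMap_zero, abs_div, div_lt_iff₀ hp] at h0
      rw [hS.invFun_comp_pathMap_one, abs_div, div_lt_iff₀ hp] at h1
      exact (hS.invFun_comp_pathMap_eq_id_iff p q).2 (hcon p q h0 h1)
    · rintro rfl
      exact ⟨by simpa using hε, .nil, .nil, ((hS.invFun_comp_pathMap_eq_id_iff _ _).2 rfl).symm⟩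

/-- Appending a path back to `w` turns paths with common ends into loops and leaves the quotient map
unchanged, so the loop condition applies with the same constant. -/
theorem exists_pos_of_gdwsp [Finite V] (hV : Quiver.IsStronglyConnected V)
    (hS : IsSimilaritySystem S) (h : GDWSP S) :
    ∃ ε > 0, ∀ (w v : V) (p q : Quiver.Path w v),
      |pathMap S q 0 - pathMap S p 0| < ε * |slope S p| →
      |pathMap S q 1 - pathMap S p 1| < ε * |slope S p| → pathMap S p = pathMap S q := by
  choose ε hε hiso using fun v => hS.exists_pos_of_idIsolatedAt (h v)
  obtain ⟨e, he, -, hle⟩ := exists_pos_forall_le ε hε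
  refine ⟨e, he, fun w v p q h0 h1 => ?_⟩
  obtain ⟨b⟩ := hV v w
  have hb := hS.abs_slope_pos b
  have hp := hS.abs_slope_pos p
  have hlt : ∀ x, |pathMap S q x - pathMap S p x| < e * |slope S p| →
      |pathMap S (q.comp b) x - pathMap S (p.comp b) x| < ε w * |slope S (p.comp b)| := by
    intro x hx
    rw [pathMap_comp, pathMap_comp, Function.comp_apply, Function.comp_apply, hS.abs_pathMap_sub,
      hS.slope_comp, abs_mul]
    calc |slope S b| * |pathMap S q x - pathMap S p x| < |slope S b| * (e * |slope S p|) := by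
          gcongr
      _ ≤ |slope S b| * (ε w * |slope S p|) := by gcongr; exact hle w
      _ = _ := by ring
  have key := hiso w _ _ (hlt 0 h0) (hlt 1 h1)
  rw [pathMap_comp, pathMap_comp] at key
  funext x
  exact (hS.bijective_pathMap b).injective (congrFun key x)

/-! ### Consequences of the weak separation property -/

theorem exists_finset_representatives {α β : Type*} (G : Set α) (B : Finset β) (code : α → β)
    (h : MapsTo code G B) :
    ∃ I : Finset α, ↑I ⊆ G ∧ I.card ≤ B.card ∧ ∀ a ∈ G, ∃ b ∈ I, code b = code a := by
  classical
  rcases G.eq_empty_or_nonempty with rfl | ⟨a₀, ha₀⟩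
  · exact ⟨∅, by simp⟩
  have hsec : ∀ b : β, ∃ a ∈ G, (∃ a' ∈ G, code a' = b) → code a = b := by
    intro b
    by_cases hb : ∃ a' ∈ G, code a' = b
    · obtain ⟨a, ha, hab⟩ := hb
      exact ⟨a, ha, fun _ => hab⟩
    · exact ⟨a₀, ha₀, fun h => absurd h hb⟩
  choose g hgG hg using hsec
  refine ⟨B.image g, fun a ha => ?_, Finset.card_image_le, fun a ha => ?_⟩
  · obtain ⟨b, -, rfl⟩ := Finset.mem_image.1 (Finset.mem_coe.1 ha)
    exact hgG b
  · exact ⟨g (code a), Finset.mem_image_of_mem _ (h ha), hg _ ⟨a, ha, rfl⟩⟩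

/-- Under the weak separation property, the part of `F v` in a ball is covered by boundedly many
copies of the sets `F w`, of size at most the radius of the ball. -/
theorem exists_finset_paths_of_gdwsp [Finite V] [∀ u v : V, Finite (u ⟶ v)]
    (hV : Quiver.IsStronglyConnected V) (hS : IsSimilaritySystem S) (hF : IsAttractorFamily S F)
    (h : GDWSP S) (v : V) : ∃ N : ℕ, ∀ x R : ℝ, 0 < R → R ≤ 1 →
      ∃ I : Finset (Σ w : V, Quiver.Path w v), I.card ≤ N ∧ (∀ p ∈ I, |slope S p.2| ≤ R) ∧
        F v ∩ ball x R ⊆ ⋃ p ∈ I, pathMap S p.2 '' F p.1 := by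
  classical
  have := Fintype.ofFinite V
  obtain ⟨ε, hε, hiso⟩ := exists_pos_of_gdwsp hV hS h
  obtain ⟨κ, hκ, hκ1, hpath⟩ := exists_path_ratio hS hF
  -- End points of the relevant cylinders are within `2 * R` of `x`, hence within `2 / (ε * κ)` grid
  -- cells; the extra 1 allows for rounding down.
  let n : ℤ := ⌈2 / (ε * κ)⌉ + 1
  let B : Finset (V × ℤ × ℤ) := Finset.univ ×ˢ Finset.Icc (-n) n ×ˢ Finset.Icc (-n) n
  refine ⟨B.card, fun x R hR hR1 => ?_⟩
  -- Equal codes put both end points within `ε * κ * R ≤ ε * |slope S p|`, so separation makes the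
  -- two maps equal.
  let code : (Σ w : V, Quiver.Path w v) → V × ℤ × ℤ := fun p =>
    (p.1, ⌊(pathMap S p.2 0 - x) / (ε * κ * R)⌋, ⌊(pathMap S p.2 1 - x) / (ε * κ * R)⌋)
  let G : Set (Σ w : V, Quiver.Path w v) := {p | κ * R ≤ |slope S p.2| ∧ |slope S p.2| ≤ R ∧
    ∃ y ∈ F p.1, pathMap S p.2 y ∈ ball x R}
  have hfloor : ∀ a, |a - x| ≤ 2 * R → ⌊(a - x) / (ε * κ * R)⌋ ∈ Finset.Icc (-n) n := by
    intro a ha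
    have h1 : |(a - x) / (ε * κ * R)| ≤ 2 / (ε * κ) := by
      have : 0 < ε * κ * R := by positivity
      rw [abs_div, abs_of_pos this, div_le_div_iff₀ this (by positivity)]
      calc |a - x| * (ε * κ) ≤ 2 * R * (ε * κ) := by gcongr
        _ = _ := by ring
    have h2 := h1.trans (Int.le_ceil _)
    rw [abs_le] at h2
    rw [Finset.mem_Icc]
    constructor
    · rw [Int.le_floor]
      push_cast [n]
      linarith
    · have : ⌊(a - x) / (ε * κ * R)⌋ ≤ ⌈2 / (ε * κ)⌉ := by
        exact_mod_cast (Int.floor_le _).trans h2.2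
      omega
  have hclose : ∀ p ∈ G, ∀ z ∈ Icc (0 : ℝ) 1, |pathMap S p.2 z - x| ≤ 2 * R := by
    rintro ⟨w, p⟩ ⟨-, h2, y, hy, hyx⟩ z hz
    simp only at h2 hy hyx ⊢
    rw [mem_ball, Real.dist_eq] at hyx
    have h3 := abs_sub_le (pathMap S p z) (pathMap S p y) x
    rw [hS.abs_pathMap_sub] at h3
    have hy01 := hF.subset w hy
    have h4 : |z - y| ≤ 1 := by
      rw [abs_le]
      constructor <;> linarith [hz.1, hz.2, hy01.1, hy01.2]
    nlinarith [abs_nonneg (slope S p)]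
  obtain ⟨I, hIG, hIc, hI⟩ := exists_finset_representatives G B code fun p hp =>
    Finset.mem_coe.2 (Finset.mk_mem_product (Finset.mem_univ _) (Finset.mk_mem_product
      (hfloor _ (hclose p hp 0 (left_mem_Icc.2 zero_le_one)))
      (hfloor _ (hclose p hp 1 (right_mem_Icc.2 zero_le_one)))))
  refine ⟨I, hIc, fun p hp => (hIG hp).2.1, fun z hz => ?_⟩
  obtain ⟨w, p, y, hy, hyz, h1, h2⟩ := hpath v z hz.1 R hR hR1
  obtain ⟨⟨w', q⟩, hqI, hcode⟩ := hI ⟨w, p⟩ ⟨h1, h2, y, hy, by rw [hyz]; exact hz.2⟩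
  simp only [code, Prod.mk.injEq] at hcode
  obtain ⟨rfl, h3, h4⟩ := hcode
  have hlt : ∀ a b : ℝ, ⌊(a - x) / (ε * κ * R)⌋ = ⌊(b - x) / (ε * κ * R)⌋ →
      |b - a| < ε * |slope S p| := by
    intro a b hab
    have h5 := Int.abs_sub_lt_one_of_floor_eq_floor hab.symm
    have h6 : 0 < ε * κ * R := by positivity
    rw [← sub_div, abs_div, abs_of_pos h6, div_lt_one h6] at h5
    calc |b - a| = |b - x - (a - x)| := by ring_nf
      _ < ε * κ * R := h5
      _ = ε * (κ * R) := by ring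
      _ ≤ _ := by gcongr
  have heq := hiso _ _ p q (hlt _ _ h3.symm) (hlt _ _ h4.symm)
  refine mem_iUnion₂.2 ⟨⟨w', q⟩, hqI, y, hy, ?_⟩
  rw [← hyz, heq]

theorem coverNumber_ne_top {E : Set ℝ} (hE : IsCompact E) {r : ℝ} (hr : 0 < r) :
    coverNumber r E ≠ ⊤ := by
  obtain ⟨A, hA⟩ := hE.elim_finite_subcover (fun x : ℝ => ball x (r / 2)) (fun _ => isOpen_ball)
    fun x _ => mem_iUnion.2 ⟨x, mem_ball_self (half_pos hr)⟩
  exact ne_top_of_le_ne_top (ENat.natCast_ne_top _) (coverNumber_le_card A _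
    (fun x _ => ⟨isOpen_ball, (ediam_ball_le _ _).trans_eq (by ring_nf)⟩) hA)

/-- Each of the boundedly many cylinders has size at most `R`, and its `F w` embeds in `F v` with
ratio at least `κ`. -/
theorem exists_coverNumber_inter_ball_le [Finite V] [∀ u v : V, Finite (u ⟶ v)]
    (hV : Quiver.IsStronglyConnected V) (hS : IsSimilaritySystem S) (hF : IsAttractorFamily S F)
    (h : GDWSP S) (v : V) : ∃ N : ℕ, 0 < N ∧ ∃ κ : ℝ, 0 < κ ∧ κ ≤ 1 ∧ ∀ x R r : ℝ, 0 < R → R ≤ 1 →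
      0 < r → coverNumber r (F v ∩ ball x R) ≤ N * coverNumber (r / (R / κ)) (F v) := by
  obtain ⟨N, hN⟩ := exists_finset_paths_of_gdwsp hV hS hF h v
  obtain ⟨κ, hκ, hκ1, hconn⟩ := exists_connecting_ratio hV hS
  refine ⟨N + 1, N.succ_pos, κ, hκ, hκ1, fun x R r hR hR1 hr => ?_⟩
  obtain ⟨I, hIc, hIR, hI⟩ := hN x R hR hR1
  have hone : ∀ p ∈ I, coverNumber r (pathMap S p.2 '' F p.1) ≤
      coverNumber (r / (R / κ)) (F v) := by
    rintro ⟨w, p⟩ hp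
    obtain ⟨b, hb⟩ := hconn w v
    have hp0 := hS.abs_slope_pos p
    calc coverNumber r (pathMap S p '' F w) ≤ coverNumber (r / |slope S p|) (F w) :=
          coverNumber_image_le hp0 (hS.abs_pathMap_sub p) (hS.bijective_pathMap p).surjective
      _ ≤ coverNumber (r / R) (F w) :=
          coverNumber_mono subset_rfl (div_le_div_of_nonneg_left hr.le hp0 (hIR _ hp))
      _ ≤ coverNumber (|slope S b| * (r / R)) (F v) :=
          coverNumber_preimage_le (hS.abs_slope_pos b) (hS.abs_pathMap_sub b) (hF.mapsTo_pathMap b)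
      _ ≤ coverNumber (r / (R / κ)) (F v) := by
          refine coverNumber_mono subset_rfl ?_
          rw [div_div_eq_mul_div, mul_comm r κ, mul_div_assoc]
          gcongr
  calc coverNumber r (F v ∩ ball x R) ≤ coverNumber r (⋃ p ∈ I, pathMap S p.2 '' F p.1) :=
        coverNumber_mono hI le_rfl
    _ ≤ ∑ p ∈ I, coverNumber r (pathMap S p.2 '' F p.1) := coverNumber_biUnion_le _ _ _
    _ ≤ ∑ _p ∈ I, coverNumber (r / (R / κ)) (F v) := Finset.sum_le_sum hone
    _ = (I.card : ℕ∞) * coverNumber (r / (R / κ)) (F v) := by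
        rw [Finset.sum_const, nsmul_eq_mul]
    _ ≤ ((N + 1 : ℕ) : ℕ∞) * coverNumber (r / (R / κ)) (F v) := by
        gcongr
        exact hIc.trans N.le_succ

/-- A sub-self-similar recurrence for covering numbers gives a power bound. -/
theorem coverNumber_le_of_recurrence {E : Set ℝ} (hE : IsCompact E) {ι : Type*} {A : Finset ι}
    (hA : A.Nonempty) {θ : ι → ℝ} (hθ : ∀ i ∈ A, 0 < θ i) (hθ1 : ∀ i ∈ A, θ i < 1) {N : ℕ} {t : ℝ}
    (ht : 0 ≤ t) (hsum : N * ∑ i ∈ A, θ i ^ t ≤ 1)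
    (hrec : ∀ r, 0 < r → coverNumber r E ≤ ∑ i ∈ A, N * coverNumber (r / θ i) E) :
    ∃ C : ℝ, ∀ r : ℝ, 0 < r → r < 1 → (coverNumber r E : ℝ≥0∞) ≤ ENNReal.ofReal (C * r ^ (-t)) := by
  obtain ⟨i₀, hi₀, hmin⟩ := A.exists_min_image θ hA
  obtain ⟨i₁, hi₁, hmax⟩ := A.exists_max_image θ hA
  have hne := coverNumber_ne_top hE (hθ i₀ hi₀)
  let C : ℝ := (coverNumber (θ i₀) E).toNat
  have hC0 : 0 ≤ C := Nat.cast_nonneg _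
  have hC : (coverNumber (θ i₀) E : ℝ≥0∞) = ENNReal.ofReal C := by
    rw [ENNReal.ofReal_natCast]
    conv_lhs => rw [← ENat.natCast_toNat hne]
    simp
  -- Scales between the least ratio and 1 form the base case; below them every `r / θ i` is still at
  -- most 1.
  have hbase : ∀ r, θ i₀ ≤ r → r ≤ 1 →
      (coverNumber r E : ℝ≥0∞) ≤ ENNReal.ofReal (C * r ^ (-t)) := by
    intro r hr hr1
    have hr0 : 0 < r := (hθ i₀ hi₀).trans_le hr
    calc (coverNumber r E : ℝ≥0∞) ≤ coverNumber (θ i₀) E := by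
          exact_mod_cast coverNumber_mono subset_rfl hr
      _ = ENNReal.ofReal C := hC
      _ ≤ _ := ENNReal.ofReal_le_ofReal (le_mul_of_one_le_right hC0
          (Real.one_le_rpow_of_pos_of_le_one_of_nonpos hr0 hr1 (by linarith)))
  have key : ∀ n : ℕ, ∀ r, θ i₁ ^ n ≤ r → 0 < r → r ≤ 1 →
      (coverNumber r E : ℝ≥0∞) ≤ ENNReal.ofReal (C * r ^ (-t)) := by
    intro n
    induction n with
    | zero =>
      intro r hr _ hr1
      rw [pow_zero] at hr
      exact hbase r ((hθ1 i₀ hi₀).le.trans hr) hr1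
    | succ n ih =>
      intro r hr hr0 hr1
      rcases le_or_gt (θ i₀) r with hle | hlt
      · exact hbase r hle hr1
      have hstep : ∀ i ∈ A, (N * coverNumber (r / θ i) E : ℝ≥0∞) ≤
          ENNReal.ofReal (C * r ^ (-t) * (N * θ i ^ t)) := by
        intro i hi
        have hi0 := hθ i hi
        have h1 := ih (r / θ i) (by
          rw [le_div_iff₀ hi0]
          calc θ i₁ ^ n * θ i ≤ θ i₁ ^ n * θ i₁ := by
                have := (hθ i₁ hi₁).le
                gcongr
                exact hmax i hi
            _ ≤ r := by rwa [← pow_succ]) (by positivity)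
          ((div_le_one hi0).2 (hlt.le.trans (hmin i hi)))
        calc (N * coverNumber (r / θ i) E : ℝ≥0∞)
            ≤ ENNReal.ofReal N * ENNReal.ofReal (C * (r / θ i) ^ (-t)) := by
              rw [ENNReal.ofReal_natCast]
              gcongr
          _ = _ := by
              rw [← ENNReal.ofReal_mul (Nat.cast_nonneg _), Real.div_rpow hr0.le hi0.le,
                Real.rpow_neg hi0.le, div_inv_eq_mul]
              congr 1
              ring
      have hpos : 0 ≤ C * r ^ (-t) := by positivity
      calc (coverNumber r E : ℝ≥0∞) ≤ ((∑ i ∈ A, N * coverNumber (r / θ i) E : ℕ∞) : ℝ≥0∞) := by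
            exact_mod_cast hrec r hr0
        _ = ∑ i ∈ A, (N * coverNumber (r / θ i) E : ℝ≥0∞) := by
            rw [← ENat.toENNRealRingHom_apply, map_sum]
            simp
        _ ≤ ∑ i ∈ A, ENNReal.ofReal (C * r ^ (-t) * (N * θ i ^ t)) := Finset.sum_le_sum hstep
        _ = ENNReal.ofReal (C * r ^ (-t) * (N * ∑ i ∈ A, θ i ^ t)) := by
            rw [← ENNReal.ofReal_sum_of_nonneg, Finset.mul_sum, Finset.mul_sum]
            intro i hi
            have := hθ i hi
            positivity
        _ ≤ _ := ENNReal.ofReal_le_ofReal (mul_le_of_le_one_right hpos hsum)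
  refine ⟨C, fun r hr hr1 => ?_⟩
  obtain ⟨n, hn⟩ := exists_pow_lt_of_lt_one hr (hθ1 i₁ hi₁)
  exact key n r hn.le hr hr1.le

theorem hausdorffMeasure_ne_zero_of_gdwsp [Finite V] [∀ u v : V, Finite (u ⟶ v)]
    (hV : Quiver.IsStronglyConnected V) (hS : IsSimilaritySystem S) (hF : IsAttractorFamily S F)
    (h : GDWSP S) {v : V} {s : ℝ≥0} (hs : dimH (F v) = s) : μH[(s : ℝ)] (F v) ≠ 0 := by
  intro h0
  obtain ⟨x₀, hx₀⟩ := hF.nonempty v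
  have hs0 : (0 : ℝ) < s := by
    refine lt_of_le_of_ne s.2 fun hs0 => ?_
    have hs0 : (s : ℝ) = 0 := hs0.symm
    have h1 := measure_mono (μ := μH[(0 : ℝ)]) (singleton_subset_iff.2 hx₀)
    rw [Measure.hausdorffMeasure_zero_singleton, ← hs0, h0] at h1
    exact one_ne_zero (nonpos_iff_eq_zero.1 h1)
  obtain ⟨N, hN, κ, hκ, hκ1, hcov⟩ := exists_coverNumber_inter_ball_le hV hS hF h v
  have hN' : (0 : ℝ) < N := Nat.cast_pos.2 hN
  -- The weight `κ ^ s / N` is just what makes `N * ∑ (radius / κ) ^ s < 1`; by continuity this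
  -- persists for some `t < s`.
  obtain ⟨I, hI, hIs⟩ := exists_isBallCover_of_hausdorffMeasure_eq_zero (hF.isCompact v) hs0 h0
    (ε := κ ^ (s : ℝ) / N) (by positivity)
  have hIne : I.Nonempty := by
    obtain ⟨p, hp, -⟩ := mem_iUnion₂.1 (hI.cover hx₀)
    exact ⟨p, hp⟩
  have hlt : (N : ℝ) * ∑ p ∈ I, (p.2 / κ) ^ (s : ℝ) < 1 := by
    have h1 : ∑ p ∈ I, (p.2 / κ) ^ (s : ℝ) = (∑ p ∈ I, p.2 ^ (s : ℝ)) / κ ^ (s : ℝ) := by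
      rw [Finset.sum_div]
      exact Finset.sum_congr rfl fun p hp => Real.div_rpow (hI.pos p hp).le hκ.le _
    rw [h1, ← mul_div_assoc, div_lt_one (by positivity)]
    rw [lt_div_iff₀ hN'] at hIs
    linarith
  have hθ : ∀ p ∈ I, 0 < p.2 / κ := fun p hp => div_pos (hI.pos p hp) hκ
  have hκs : κ ^ (s : ℝ) / N ≤ κ ^ (s : ℝ) :=
    div_le_self (by positivity) (by exact_mod_cast hN)
  have hθ1 : ∀ p ∈ I, p.2 / κ < 1 := by
    intro p hp
    have h1 : p.2 ^ (s : ℝ) ≤ ∑ q ∈ I, q.2 ^ (s : ℝ) :=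
      Finset.single_le_sum (f := fun q : ℝ × ℝ => q.2 ^ (s : ℝ))
        (fun q hq => Real.rpow_nonneg (hI.pos q hq).le _) hp
    rw [div_lt_one hκ]
    exact (Real.rpow_lt_rpow_iff (hI.pos p hp).le hκ.le hs0).1 (by linarith)
  have hcont : ContinuousAt (fun t : ℝ => (N : ℝ) * ∑ p ∈ I, (p.2 / κ) ^ t) s :=
    tendsto_const_nhds.mul (tendsto_finsetSum _ fun p hp =>
      (Real.continuousAt_const_rpow (hθ p hp).ne').tendsto)
  have h1 : ∀ᶠ t in 𝓝[<] (s : ℝ), (N : ℝ) * ∑ p ∈ I, (p.2 / κ) ^ t < 1 :=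
    (hcont.tendsto.mono_left nhdsWithin_le_nhds).eventually_lt_const hlt
  have h2 : ∀ᶠ t : ℝ in 𝓝[<] (s : ℝ), t < s := self_mem_nhdsWithin
  obtain ⟨t, ht, hts, ht0⟩ := (h1.and (h2.and
    ((eventually_gt_nhds hs0).filter_mono nhdsWithin_le_nhds))).exists
  obtain ⟨C, hC⟩ := coverNumber_le_of_recurrence (hF.isCompact v) hIne hθ hθ1 ht0.le ht.le
    fun r hr => by
      calc coverNumber r (F v) ≤ coverNumber r (⋃ p ∈ I, F v ∩ ball p.1 p.2) := by
            refine coverNumber_mono (fun y hy => ?_) le_rfl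
            obtain ⟨p, hp, hyp⟩ := mem_iUnion₂.1 (hI.cover hy)
            exact mem_iUnion₂.2 ⟨p, hp, hy, hyp⟩
        _ ≤ ∑ p ∈ I, coverNumber r (F v ∩ ball p.1 p.2) := coverNumber_biUnion_le _ _ _
        _ ≤ _ := Finset.sum_le_sum fun p hp => hcov p.1 p.2 r (hI.pos p hp)
            (by have := hθ1 p hp; rw [div_lt_one hκ] at this; linarith) hr
  have hfin := hausdorffMeasure_ne_top_of_coverNumber_le ht0.le hC
  lift t to ℝ≥0 using ht0.le
  have := dimH_le_of_hausdorffMeasure_ne_top hfin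
  rw [hs, ENNReal.coe_le_coe] at this
  exact this.not_gt (NNReal.coe_lt_coe.1 hts)

/-! ### Failure of the weak separation property -/

/-- At some scale `d`, an interval of length `2 * K * d` is contained in the closed
`d`-neighbourhood of `E`. -/
def IsCoarselyDense (E : Set ℝ) (K : ℝ) : Prop :=
  ∃ a d : ℝ, 0 < d ∧ ∀ y, |y - a| ≤ K * d → ∃ x ∈ E, |x - y| ≤ d

theorem IsCoarselyDense.mono {E : Set ℝ} {K K' : ℝ} (h : IsCoarselyDense E K) (hK : K' ≤ K) :
    IsCoarselyDense E K' := by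
  obtain ⟨a, d, hd, h⟩ := h
  exact ⟨a, d, hd, fun y hy => h y (hy.trans (by gcongr))⟩

/-- The `d`-neighbourhood of a set of diameter at most `d` has length at most `3 * d`, and such
neighbourhoods must cover an interval of length `2 * K * d`. -/
theorem IsCoarselyDense.le_coverNumber {E : Set ℝ} {K : ℝ} (hK : 0 ≤ K)
    (h : IsCoarselyDense E K) : ∃ x ∈ E, ∃ d > 0,
      ENNReal.ofReal (2 * K / 3) ≤ coverNumber d (ball x ((K + 3) * d) ∩ E) := by
  obtain ⟨a, d, hd, h⟩ := h
  obtain ⟨x₀, hx₀, hx₀a⟩ := h a (by rw [sub_self, abs_zero]; positivity)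
  refine ⟨x₀, hx₀, d, hd, ?_⟩
  by_cases htop : coverNumber d (ball x₀ ((K + 3) * d) ∩ E) = ⊤
  · rw [htop]; simp
  obtain ⟨𝒰, h1, h2, h3⟩ := exists_finset_of_coverNumber_ne_top htop
  rw [← h3]
  let N : Set ℝ → Set ℝ := fun U => {y | ∃ x ∈ U, |x - y| ≤ d}
  have hsub : Icc (a - K * d) (a + K * d) ⊆ ⋃ U ∈ 𝒰, N U := by
    intro y hy
    have hya : |y - a| ≤ K * d := abs_le.2 ⟨by linarith [hy.1], by linarith [hy.2]⟩
    obtain ⟨x, hx, hxy⟩ := h y hya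
    have hball : x ∈ ball x₀ ((K + 3) * d) ∩ E := by
      refine ⟨?_, hx⟩
      rw [mem_ball, Real.dist_eq]
      rw [abs_sub_comm] at hx₀a
      linarith [abs_sub_le x y x₀, abs_sub_le y a x₀]
    obtain ⟨U, hU, hxU⟩ := mem_iUnion₂.1 (h2 hball)
    exact mem_iUnion₂.2 ⟨U, hU, x, hxU, hxy⟩
  have hdiam : ∀ U ∈ 𝒰, volume (N U) ≤ ENNReal.ofReal (3 * d) := by
    intro U hU
    refine (Real.volume_le_diam _).trans (ediam_le_of_forall_dist_le ?_)
    rintro y ⟨x, hx, hxy⟩ z ⟨x', hx', hxz⟩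
    have h4 := (edist_le_ediam_of_mem hx hx').trans (h1 U hU).2
    rw [edist_dist, ENNReal.ofReal_le_ofReal_iff hd.le, Real.dist_eq] at h4
    rw [Real.dist_eq]
    rw [abs_sub_comm] at hxy
    linarith [abs_sub_le y x z, abs_sub_le x x' z]
  have hvol : ENNReal.ofReal (2 * K * d) ≤ 𝒰.card * ENNReal.ofReal (3 * d) := by
    calc ENNReal.ofReal (2 * K * d) = volume (Icc (a - K * d) (a + K * d)) := by
          rw [Real.volume_Icc]; congr 1; ring
      _ ≤ volume (⋃ U ∈ 𝒰, N U) := measure_mono hsub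
      _ ≤ ∑ U ∈ 𝒰, volume (N U) := measure_biUnion_finset_le _ _
      _ ≤ ∑ _U ∈ 𝒰, ENNReal.ofReal (3 * d) := Finset.sum_le_sum hdiam
      _ = _ := by rw [Finset.sum_const, nsmul_eq_mul]
  rw [← ENNReal.ofReal_natCast, ← ENNReal.ofReal_mul (Nat.cast_nonneg _),
    ENNReal.ofReal_le_ofReal_iff (by positivity)] at hvol
  rw [ENat.toENNReal_coe, ← ENNReal.ofReal_natCast]
  refine ENNReal.ofReal_le_ofReal ?_
  have h5 : 2 * K ≤ 𝒰.card * 3 := le_of_mul_le_mul_right (by linarith) hd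
  linarith

theorem one_le_dimAssouad {E : Set ℝ} (h : ∀ K, IsCoarselyDense E K) : 1 ≤ dimAssouad E := by
  refine le_iInf₂ fun t ht => ?_
  obtain ⟨C, hC, hbound⟩ := ht
  by_contra! hlt
  have ht1 : (t : ℝ) < 1 := by exact_mod_cast hlt
  -- For `t < 1`, the lower bound `2 * K / 3` outgrows `C * (K + 3) ^ t ≤ 2 * C * K ^ t`.
  obtain ⟨K, hK3, hKC⟩ := ((eventually_ge_atTop (3 : ℝ)).and
    ((tendsto_rpow_atTop (sub_pos.2 ht1)).eventually_gt_atTop (3 * C))).exists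
  have hK0 : 0 < K := by linarith
  obtain ⟨x, hx, d, hd, hle⟩ := (h K).le_coverNumber hK0.le
  have h1 := hle.trans (hbound ((K + 3) * d) (by positivity) d hd (by nlinarith) x hx)
  rw [mul_div_cancel_right₀ _ hd.ne', ENNReal.ofReal_le_ofReal_iff (by positivity)] at h1
  have h2 : (K + 3) ^ (t : ℝ) ≤ 2 * K ^ (t : ℝ) :=
    calc (K + 3) ^ (t : ℝ) ≤ (2 * K) ^ (t : ℝ) :=
          Real.rpow_le_rpow (by positivity) (by linarith) t.2
      _ = 2 ^ (t : ℝ) * K ^ (t : ℝ) := Real.mul_rpow two_pos.le hK0.le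
      _ ≤ 2 * K ^ (t : ℝ) := by
          gcongr
          exact Real.rpow_le_self_of_one_le one_le_two ht1.le
  have h3 : K ^ (1 - (t : ℝ)) * K ^ (t : ℝ) = K := by
    rw [← Real.rpow_add hK0, sub_add_cancel, Real.rpow_one]
  have h4 : 0 < K ^ (t : ℝ) := by positivity
  have h5 : 3 * C * K ^ (t : ℝ) < K := by
    calc 3 * C * K ^ (t : ℝ) < K ^ (1 - (t : ℝ)) * K ^ (t : ℝ) := by gcongr
      _ = K := h3
  nlinarith

theorem isCoarselyDense_one {E : Set ℝ} (hE : E.Nonempty) : IsCoarselyDense E 1 := by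
  obtain ⟨x, hx⟩ := hE
  exact ⟨x, 1, one_pos, fun y hy => ⟨x, hx, by rw [abs_sub_comm]; linarith⟩⟩

/-- Intervals of half-length `L` about `-h` and `h` overlap and fill the one of half-length `L +
|h|` about 0. -/
theorem abs_le_or_abs_sub_le {u h L : ℝ} (hh : |h| ≤ L) (hu : |u| ≤ L + |h|) :
    |u + h| ≤ L ∨ |u - h| ≤ L := by
  rcases abs_cases u with ⟨e1, _⟩ | ⟨e1, _⟩ <;> rcases abs_cases h with ⟨e2, _⟩ | ⟨e2, _⟩ <;>
    rw [e1, e2] at hu <;> rw [e2] at hh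
  · exact Or.inr (abs_le.2 ⟨by linarith, by linarith⟩)
  · exact Or.inl (abs_le.2 ⟨by linarith, by linarith⟩)
  · exact Or.inl (abs_le.2 ⟨by linarith, by linarith⟩)
  · exact Or.inr (abs_le.2 ⟨by linarith, by linarith⟩)

/-- Two loops with nearly equal but distinct maps can be precomposed with a loop so that the
quotient of the resulting maps is nearly a translation by an amount comparable to `D`. -/
theorem exists_near_translation {v : V} (hS : IsSimilaritySystem S) (hF : IsAttractorFamily S F)
    (hnt : (F v).Nontrivial) (hiso : ¬ IdIsolatedAt S v) {κ : ℝ} (hκ : 0 < κ)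
    (hloop : ∀ x ∈ F v, ∀ δ, 0 < δ → δ ≤ 1 →
      ∃ p : Quiver.Path v v, κ * δ ≤ |slope S p| ∧ |slope S p| ≤ δ ∧
        ∀ z ∈ Icc (0 : ℝ) 1, |pathMap S p z - x| ≤ δ) {D e : ℝ} (hD : 0 < D) (he : 0 < e) :
    ∃ (α β : Quiver.Path v v) (τ : ℝ), D ≤ |τ| ∧ |τ| ≤ D / κ ∧ ∀ z ∈ Icc (0 : ℝ) 1, ∀ z',
      pathMap S α z' = pathMap S β z → |z' - (z + τ)| ≤ e := by
  -- The bound `ε ≤ D` makes the zoom size `η / D` admissible; `2 * ε ≤ κ * e` controls the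
  -- deviation from a translation.
  let ε := min D (κ * e / 2)
  have hε : 0 < ε := lt_min hD (by positivity)
  have hεD : ε ≤ D := min_le_left _ _
  have hεe : 2 * ε ≤ κ * e := by
    have : ε ≤ κ * e / 2 := min_le_right _ _
    linarith
  obtain ⟨α, β, h0, h1, hne⟩ := hS.exists_paths_of_not_idIsolatedAt hiso hε
  have hα := hS.abs_slope_pos α
  have hα0 := hS.slope_ne_zero α
  let Δ : ℝ → ℝ := fun x => pathMap S β x - pathMap S α x
  have hΔ : ∀ x, Δ x = Δ 0 + (Δ 1 - Δ 0) * x := fun x => by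
    simp only [Δ]
    rw [hS.pathMap_apply β x, hS.pathMap_apply α x, slope, slope]
    ring
  have h0 : |Δ 0| < ε * |slope S α| := h0
  have h1 : |Δ 1| < ε * |slope S α| := h1
  -- A non-zero affine function cannot vanish at two points of `F v`.
  obtain ⟨x, hx, hxne⟩ : ∃ x ∈ F v, Δ x ≠ 0 := by
    by_contra! hcon
    obtain ⟨y, hy, z, hz, hyz⟩ := hnt
    have h2 := hcon y hy
    have h3 := hcon z hz
    rw [hΔ] at h2 h3
    have h4 : (Δ 1 - Δ 0) * (y - z) = 0 := by linear_combination h2 - h3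
    have h5 := (mul_eq_zero.1 h4).resolve_right (sub_ne_zero.2 hyz)
    rw [h5, zero_mul, add_zero] at h2
    refine hne (funext fun w => ?_)
    have h6 := hΔ w
    rw [h5, h2, zero_mul, add_zero] at h6
    exact (sub_eq_zero.1 h6).symm
  have hx01 := hF.subset v hx
  have hxlt : |Δ x| < ε * |slope S α| := by
    have h2 : Δ x = (1 - x) * Δ 0 + x * Δ 1 := by rw [hΔ x]; ring
    rw [abs_lt] at h0 h1 ⊢
    rw [h2]
    obtain ⟨hx0, hx1⟩ := hx01
    rcases eq_or_lt_of_le hx0 with rfl | hx0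
    · constructor <;> linarith [h0.1, h0.2]
    · constructor <;> nlinarith [h0.1, h0.2, h1.1, h1.2]
  have hη : 0 < |Δ x| / |slope S α| := div_pos (abs_pos.2 hxne) hα
  have hηε : |Δ x| / |slope S α| < ε := (div_lt_iff₀ hα).2 hxlt
  set η := |Δ x| / |slope S α|
  -- Zooming in at `x` to size about `η / D` magnifies the relative displacement `η` to between `D`
  -- and `D / κ`, while `Δ` stays nearly constant there.
  obtain ⟨p, hp1, hp2, hp3⟩ := hloop x hx (η / D) (by positivity)
    ((div_le_one hD).2 (hηε.le.trans hεD))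
  have hp := hS.abs_slope_pos p
  have hp0 := hS.slope_ne_zero p
  have hτ : |Δ x / (slope S α * slope S p)| = η / |slope S p| := by
    rw [abs_div, abs_mul, div_mul_eq_div_div]
  refine ⟨p.comp α, p.comp β, Δ x / (slope S α * slope S p), ?_, ?_, fun z hz z' hzz' => ?_⟩
  · rw [hτ, le_div_iff₀ hp]
    rw [le_div_iff₀ hD] at hp2
    linarith
  · rw [hτ, div_le_div_iff₀ hp hκ]
    rw [← mul_div_assoc, div_le_iff₀ hD] at hp1
    linarith
  · rw [pathMap_comp, pathMap_comp, Function.comp_apply, Function.comp_apply] at hzz'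
    have h2 : slope S α * slope S p * (z' - z) = Δ (pathMap S p z) := by
      simp only [Δ]
      rw [← hzz', hS.pathMap_sub, hS.pathMap_sub]
      ring
    have h3 : z' - (z + Δ x / (slope S α * slope S p)) =
        (Δ 1 - Δ 0) * (pathMap S p z - x) / (slope S α * slope S p) := by
      rw [eq_div_iff (mul_ne_zero hα0 hp0)]
      rw [hΔ (pathMap S p z)] at h2
      have h4 := hΔ x
      field_simp
      linear_combination h2 - h4
    rw [h3, abs_div, abs_mul, abs_mul, div_le_iff₀ (mul_pos hα hp)]
    have h4 : |Δ 1 - Δ 0| ≤ 2 * ε * |slope S α| := by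
      linarith [abs_sub (Δ 1) (Δ 0)]
    calc |Δ 1 - Δ 0| * |pathMap S p z - x| ≤ (κ * e * |slope S α|) * (η / D) := by
          gcongr
          · exact h4.trans (by gcongr)
          · exact hp3 z hz
      _ = e * |slope S α| * (κ * (η / D)) := by ring
      _ ≤ e * |slope S α| * |slope S p| := by gcongr
      _ = _ := by ring

/-- Seen through `α`, the copies by `α` and `β` are `F v` and almost its translate by `τ`, with
`|τ|` between `κ * d / 2` and `d / 2`. Their dense intervals overlap and unite to half-length `K * d
+ |τ| / 2`. The gain does not depend on `K`, so it can be repeated. -/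
theorem IsCoarselyDense.add {v : V} (hS : IsSimilaritySystem S) (hF : IsAttractorFamily S F)
    (hnt : (F v).Nontrivial) (hiso : ¬ IdIsolatedAt S v) {κ : ℝ} (hκ : 0 < κ)
    (hloop : ∀ x ∈ F v, ∀ δ, 0 < δ → δ ≤ 1 →
      ∃ p : Quiver.Path v v, κ * δ ≤ |slope S p| ∧ |slope S p| ≤ δ ∧
        ∀ z ∈ Icc (0 : ℝ) 1, |pathMap S p z - x| ≤ δ) {K : ℝ} (hK : 1 ≤ K)
    (h : IsCoarselyDense (F v) K) : IsCoarselyDense (F v) (K + κ / 8) := by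
  obtain ⟨a, d, hd, h⟩ := h
  -- The translation error coarsens the scale to `d * (1 + θ)`; this `θ` spends half of the gain `κ
  -- / 4` on it.
  let θ : ℝ := κ / 8 / (K + κ / 8)
  have hθ : 0 < θ := by positivity
  have hθK : (K + κ / 8) * (1 + θ) = K + κ / 4 := by
    have : (K + κ / 8) * θ = κ / 8 := mul_div_cancel₀ _ (by positivity)
    linarith
  obtain ⟨α, β, τ, hτ1, hτ2, hnear⟩ := exists_near_translation hS hF hnt hiso hκ hloop
    (D := κ * d / 2) (e := θ * d) (by positivity) (by positivity)
  have hτ3 : |τ| ≤ d / 2 := hτ2.trans_eq (by field_simp)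
  have hα := hS.abs_slope_pos α
  refine ⟨pathMap S α (a + τ / 2), |slope S α| * (d * (1 + θ)), by positivity, fun y hy => ?_⟩
  obtain ⟨w, rfl⟩ := (hS.bijective_pathMap α).surjective y
  rw [hS.abs_pathMap_sub] at hy
  have hw : |w - (a + τ / 2)| ≤ K * d + |τ / 2| := by
    have h1 : |slope S α| * |w - (a + τ / 2)| ≤ |slope S α| * ((K + κ / 4) * d) := by
      rw [← hθK]
      linarith
    have h2 := le_of_mul_le_mul_left h1 hα
    rw [abs_div, abs_two]
    linarith
  have hhalf : |τ / 2| ≤ K * d := by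
    rw [abs_div, abs_two]
    nlinarith
  suffices hs : ∃ z, pathMap S α z ∈ F v ∧ |z - w| ≤ d * (1 + θ) by
    obtain ⟨z, hz, hzw⟩ := hs
    refine ⟨_, hz, ?_⟩
    rw [hS.abs_pathMap_sub]
    gcongr
  rcases abs_le_or_abs_sub_le hhalf hw with hcase | hcase
  · obtain ⟨z, hz, hzw⟩ := h w (by rwa [show w - a = w - (a + τ / 2) + τ / 2 by ring])
    exact ⟨z, hF.mapsTo_pathMap α hz, hzw.trans (by nlinarith)⟩
  · obtain ⟨z, hz, hzw⟩ := h (w - τ) (by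
      rwa [show w - τ - a = w - (a + τ / 2) - τ / 2 by ring])
    obtain ⟨z', hz'⟩ := (hS.bijective_pathMap α).surjective (pathMap S β z)
    refine ⟨z', ?_, ?_⟩
    · rw [hz']
      exact hF.mapsTo_pathMap β hz
    · have h1 := hnear z (hF.subset v hz) z' hz'
      have h2 := abs_sub_le z' (z + τ) w
      rw [show z + τ - w = z - (w - τ) by ring] at h2
      linarith

theorem dimAssouad_eq_one_of_not_idIsolatedAt [Finite V] [∀ u v : V, Finite (u ⟶ v)]
    (hV : Quiver.IsStronglyConnected V) (hS : IsSimilaritySystem S) (hF : IsAttractorFamily S F)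
    {v : V} (hnt : (F v).Nontrivial) (hiso : ¬ IdIsolatedAt S v) : dimAssouad (F v) = 1 := by
  obtain ⟨κ, hκ, -, hloop⟩ := exists_loop_ratio hV hS hF
  have hall : ∀ n : ℕ, IsCoarselyDense (F v) (1 + n * (κ / 8)) := by
    intro n
    induction n with
    | zero => simpa using isCoarselyDense_one (hF.nonempty v)
    | succ n ih =>
      have := ih.add hS hF hnt hiso hκ (hloop v)
        (le_add_of_nonneg_right (by positivity))
      rwa [show (1 : ℝ) + (n + 1 : ℕ) * (κ / 8) = 1 + n * (κ / 8) + κ / 8 by push_cast; ring]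
  refine le_antisymm (dimAssouad_le_one _) (one_le_dimAssouad fun K => ?_)
  obtain ⟨n, hn⟩ := exists_nat_ge (K / (κ / 8))
  rw [div_le_iff₀ (by positivity)] at hn
  exact (hall n).mono (by linarith)

/-! ### The common dimension and the dichotomy -/

theorem dimH_le_dimH (hV : Quiver.IsStronglyConnected V) (hS : IsSimilaritySystem S)
    (hF : IsAttractorFamily S F) (u v : V) : dimH (F u) ≤ dimH (F v) := by
  obtain ⟨p⟩ := hV u v
  have hp := hS.abs_slope_pos p
  have hanti : AntilipschitzWith ⟨|slope S p|⁻¹, (inv_pos.2 hp).le⟩ (pathMap S p) :=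
    AntilipschitzWith.of_le_mul_dist fun x y => by
      rw [Real.dist_eq, Real.dist_eq, hS.abs_pathMap_sub]
      exact (inv_mul_cancel_left₀ hp.ne' _).ge
  exact (hanti.le_dimH_image _).trans (dimH_mono (hF.mapsTo_pathMap p).image_subset)

end GraphDirected

theorem theorem4p2 {V : Type*} [Finite V] [Nonempty V] [Quiver V] [∀ u v : V, Finite (u ⟶ v)]
    (hV : Quiver.IsStronglyConnected V)
    (S : ∀ u v : V, (u ⟶ v) → ℝ → ℝ) (hS : GraphDirected.IsSimilaritySystem S)
    (F : V → Set ℝ) (hF : GraphDirected.IsAttractorFamily S F) :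
    ∃ s : ℝ≥0, (∀ v, dimH (F v) = s) ∧ (s < 1 →
      (GraphDirected.GDWSP S →
        ∀ v, 0 < μH[(s : ℝ)] (F v) ∧
          GraphDirected.dimAssouad (F v) = dimH (F v) ∧ dimH (F v) = s) ∧
      (¬ GraphDirected.GDWSP S → (∃ v, (F v).Nontrivial) →
        ∀ v, μH[(s : ℝ)] (F v) = 0 ∧ GraphDirected.dimAssouad (F v) = 1)) := by
  obtain ⟨v₀⟩ := ‹Nonempty V›
  have hfin : dimH (F v₀) ≠ ⊤ :=
    ne_top_of_le_ne_top ENNReal.one_ne_top ((GraphDirected.dimH_le_dimAssouad (hF.subset v₀)).trans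
      (GraphDirected.dimAssouad_le_one _))
  have hdim : ∀ v, dimH (F v) = (dimH (F v₀)).toNNReal := fun v => by
    rw [ENNReal.coe_toNNReal hfin]
    exact le_antisymm (GraphDirected.dimH_le_dimH hV hS hF _ _)
      (GraphDirected.dimH_le_dimH hV hS hF _ _)
  refine ⟨_, hdim, fun hs => ⟨fun hG v => ?_, fun hG hnt v => ?_⟩⟩
  · have hpos := GraphDirected.hausdorffMeasure_ne_zero_of_gdwsp hV hS hF hG (hdim v)
    refine ⟨pos_iff_ne_zero.2 hpos, le_antisymm ?_
      (GraphDirected.dimH_le_dimAssouad (hF.subset v)), hdim v⟩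
    exact (GraphDirected.dimAssouad_le_of_hausdorffMeasure_ne_zero hV hS hF (hdim v) hpos).trans_eq
      (hdim v).symm
  · obtain ⟨u, hu⟩ := hnt
    obtain ⟨p⟩ := hV u v
    have hv : (F v).Nontrivial := (hu.image (hS.bijective_pathMap p).injective).mono
      (hF.mapsTo_pathMap p).image_subset
    have hiso : ¬ GraphDirected.IdIsolatedAt S v := fun h =>
      hG fun _ => hS.idIsolatedAt_of hV h
    have hA := GraphDirected.dimAssouad_eq_one_of_not_idIsolatedAt hV hS hF hv hiso
    refine ⟨?_, hA⟩
    -- Positive measure would give `1 = dimAssouad (F v) ≤ s`, against `s < 1`.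
    by_contra hpos
    have h1 := GraphDirected.dimAssouad_le_of_hausdorffMeasure_ne_zero hV hS hF (hdim v) hpos
    rw [hA] at h1
    exact h1.not_gt (by exact_mod_cast hs)
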